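/- Let $k$ be a field and $R=k[x_1,\dots,x_n]$ with the standard grading and $\mathfrak m=(x_1,\dots,x_n)$. For a monomial ideal $L$ let $G(L)$ be its unique minimal system of monomial generators. Let $J\subseteq R$ be a monomial ideal, let $x_{i_1},\dots,x_{i_m}$ be distinct variables ($m\ge 0$), let $a_{i_1},\dots,a_{i_m}$ be positive integers, and let $I=J+(x_{i_1}^{a_{i_1}},\dots,x_{i_m}^{a_{i_m}})$. Assume that $G(I)=G(J)\cup\{x_{i_1}^{a_{i_1}},\dots,x_{i_m}^{a_{i_m}}\}$. Then: 1. The minimal graded free resolution of $R/I$ is obtained by iterated mapping cones starting from that of $R/J$. Precisely, put $f_t=x_{i_t}^{a_{i_t}}$ and $I_t=J+(f_1,\dots,f_t)$ for $0\le t\le m$, so that $I_0=J$ and $I_m=I$. Starting from a complex $F^{(0)}$, for $t=1,\dots,m$ choose a minimal graded free resolution $G^{(t)}$ of $\bigl(R/(I_{t-1}:f_t)\bigr)(-a_{i_t})$ and a graded homomorphism of complexes $\psi^{(t)}:G^{(t)}\to F^{(t-1)}$ lifting the map $R/(I_{t-1}:f_t)(-a_{i_t})\to R/I_{t-1}$ given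 by multiplication by $f_t$, and let $F^{(t)}$ be the mapping cone of $\psi^{(t)}$, that is, $F^{(t)}_i=F^{(t-1)}_i\oplus G^{(t)}_{i-1}$ with differential $(x,y)\mapsto(\psi^{(t)}(y)+d(x),-d(y))$, augmented to $R/I_t$ by $F^{(t)}_0=F^{(t-1)}_0\to R/I_{t-1}\to R/I_t$. Then $R/J$ has a minimal graded free resolution; and for every minimal graded free resolution $F^{(0)}$ of $R/J$ such choices can be made for all $t=1,\dots,m$, and for all such choices $F^{(m)}$ is a minimal graded free resolution of $R/I$. 2. $\dim(R/I)\le n-m$ (where the zero ring has dimension $-\infty$). 3. For all integers $i,j$, $$\beta_{i,j}(R/I)=\sum_{\sigma\subseteq\{i_1,\dots,i_m\}}\beta_{i-|\sigma|,\,j-\ell_\sigma}\Bigl(R/\bigl(J:\textstyle\prod_{t\in\sigma}x_t^{a_t}\bigr)\Bigr),\qquad \ell_\sigma=\sum_{t\in\sigma}a_t,$$ where $\beta_{i,j}(M)$ is the number of basis elements of degree $j$ in the $i$-th module of the minimal graded free resolution of a finitely generated graded module $M$, and $\beta_{i,j}(M)=0$ for $i<0$. -/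

import Mathlib

open MvPolynomial

noncomputable section

namespace MonomialCone

universe u v

/-- The polynomial ring `k[x_1, …, x_n]`. -/
abbrev Poly (k : Type u) [Field k] (n : ℕ) : Type u := MvPolynomial (Fin n) k

section Ideals

variable {k : Type u} [Field k] {n : ℕ}

/-- A monomial (with coefficient `1`) `x_1^{s_1} ⋯ x_n^{s_n}`. -/
def IsMonomial (u : Poly k n) : Prop := ∃ s : Fin n →₀ ℕ, u = monomial s 1

/-- An ideal generated by monomials. -/
def IsMonomialIdeal (I : Ideal (Poly k n)) : Prop :=
  ∃ S : Set (Poly k n), (∀ u ∈ S, IsMonomial u) ∧ I = Ideal.span S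

/-- `G(I)`: the minimal system of monomial generators of a monomial ideal `I`, that is, the
set of the monomials of `I` which are minimal with respect to divisibility. -/
def minGens (I : Ideal (Poly k n)) : Set (Poly k n) :=
  {u | IsMonomial u ∧ u ∈ I ∧ ∀ v : Poly k n, IsMonomial v → v ∈ I → v ∣ u → v = u}

/-- The graded maximal ideal `(x_1, …, x_n)`. -/
def maxIdeal (k : Type u) [Field k] (n : ℕ) : Ideal (Poly k n) :=
  Ideal.span (Set.range (X : Fin n → Poly k n))

/-- The homogeneous piece of degree `e ∈ ℤ` of the polynomial ring (zero if `e < 0`). -/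
def polyPiece (k : Type u) [Field k] (n : ℕ) (e : ℤ) : Submodule k (Poly k n) where
  carrier := {p | ∀ s : Fin n →₀ ℕ, coeff s p ≠ 0 → ((s.degree : ℕ) : ℤ) = e}
  zero_mem' := by intro s hs; simp at hs
  add_mem' := by
    intro p q hp hq s hs
    by_cases h : coeff s p = 0
    · refine hq s ?_
      simpa [h] using hs
    · exact hp s h
  smul_mem' := by
    intro c p hp s hs
    refine hp s ?_
    intro h
    simp [h] at hs

/-- The grading of the shifted quotient `(R/A)(-d)`: its piece of degree `e` consists of the
classes of the homogeneous polynomials of degree `e - d`. -/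
def quotPiece (A : Ideal (Poly k n)) (d : ℤ) (e : ℤ) : Submodule k (Poly k n ⧸ A) :=
  (polyPiece k n (e - d)).map (Ideal.Quotient.mkₐ k A).toLinearMap

/-- The map `R/(A : f) → R/A` which is multiplication by `f`. -/
def mulMap (A : Ideal (Poly k n)) (f : Poly k n) :
    (Poly k n ⧸ (A.colon {f} : Ideal (Poly k n))) →ₗ[Poly k n] (Poly k n ⧸ A) :=
  Submodule.mapQ (A.colon {f}) A (LinearMap.mulRight (Poly k n) f) (by
    intro r hr
    simpa using Submodule.mem_colon_singleton.mp hr)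

end Ideals

/-- A graded complex `⋯ → F_2 → F_1 → F_0` of finitely generated graded free modules over
`R = k[x_1, …, x_n]`: here `F_i = ⨁_{b ∈ ι i} R(-deg i b)` is the module of functions
`ι i → R`, in which the basis element at `b` has degree `deg i b`. -/
structure GradedComplex (k : Type u) [Field k] (n : ℕ) where
  ι : ℕ → Type
  fin : ∀ i, Finite (ι i)
  deg : ∀ i, ι i → ℤ
  d : ∀ i, (ι (i + 1) → Poly k n) →ₗ[Poly k n] (ι i → Poly k n)
  d_deg : ∀ (i : ℕ) (e : ℤ) (x : ι (i + 1) → Poly k n),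
    (∀ b, x b ∈ polyPiece k n (e - deg (i + 1) b)) →
      ∀ b, d i x b ∈ polyPiece k n (e - deg i b)
  d_comp_d : ∀ i x, d i (d (i + 1) x) = 0

namespace GradedComplex

variable {k : Type u} [Field k] {n : ℕ}

/-- The free module `F_i`. -/
abbrev Mod (F : GradedComplex k n) (i : ℕ) : Type u := F.ι i → Poly k n

/-- `x ∈ F_i` is homogeneous of degree `e`. -/
def IsHomog (F : GradedComplex k n) (i : ℕ) (e : ℤ) (x : F.Mod i) : Prop :=
  ∀ b, x b ∈ polyPiece k n (e - F.deg i b)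

/-- The number of basis elements of degree `j` of `F_i`. -/
def count (F : GradedComplex k n) (i : ℕ) (j : ℤ) : ℕ := Nat.card {b : F.ι i // F.deg i b = j}

/-- `⋯ → F_1 → F_0 → M → 0`, with augmentation `ε : F_0 → M`, is a minimal graded free
resolution of the graded module `M`, whose piece of degree `e` is `gr e`: all the maps are
graded of degree `0`, the sequence is exact, and `d (F_{i+1}) ⊆ 𝔪 F_i` for all `i`. -/
structure IsMinRes {M : Type v} [AddCommGroup M] [Module (Poly k n) M] [Module k M]
    [IsScalarTower k (Poly k n) M]
    (F : GradedComplex k n) (gr : ℤ → Submodule k M) (ε : F.Mod 0 →ₗ[Poly k n] M) : Prop where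
  graded : ∀ (e : ℤ) (x : F.Mod 0), F.IsHomog 0 e x → ε x ∈ gr e
  surjective : Function.Surjective ε
  exact_zero : Function.Exact (F.d 0) ε
  exact_succ : ∀ i, Function.Exact (F.d (i + 1)) (F.d i)
  minimal : ∀ i, LinearMap.range (F.d i) ≤ maxIdeal k n • (⊤ : Submodule (Poly k n) (F.Mod i))

/-- A graded homomorphism of complexes `G → F`. -/
structure Hom (G F : GradedComplex k n) where
  map : ∀ i, G.Mod i →ₗ[Poly k n] F.Mod i
  map_deg : ∀ (i : ℕ) (e : ℤ) (x : G.Mod i), G.IsHomog i e x → F.IsHomog i e (map i x)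
  comm : ∀ i x, F.d i (map (i + 1) x) = map i (G.d i x)

/-- Basis of the mapping cone: `M_0 = F_0` and `M_{i+1} = F_{i+1} ⊕ G_i`. -/
def coneι (F G : GradedComplex k n) : ℕ → Type
  | 0 => F.ι 0
  | i + 1 => F.ι (i + 1) ⊕ G.ι i

/-- Degrees of the basis elements of the mapping cone. -/
def coneDeg (F G : GradedComplex k n) : ∀ i, coneι F G i → ℤ
  | 0 => F.deg 0
  | i + 1 => Sum.elim (F.deg (i + 1)) (G.deg i)

/-- The differential `(x, y) ↦ (ψ y + d x, - d y)` of the mapping cone of `ψ : G → F`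
(with no second component in degree `0`). -/
def coneD {F G : GradedComplex k n} (ψ : Hom G F) :
    ∀ i, (coneι F G (i + 1) → Poly k n) →ₗ[Poly k n] (coneι F G i → Poly k n)
  | 0 =>
    { toFun := fun z : F.ι 1 ⊕ G.ι 0 → Poly k n =>
        ψ.map 0 (fun b => z (Sum.inr b)) + F.d 0 (fun b => z (Sum.inl b))
      map_add' := by
        intro z z'
        have h1 : (fun b => (z + z') (Sum.inr b)) =
          (fun b => z (Sum.inr b)) + (fun b : G.ι 0 => z' (Sum.inr b)) := rfl
        have h2 : (fun b => (z + z') (Sum.inl b)) =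
          (fun b => z (Sum.inl b)) + (fun b : F.ι 1 => z' (Sum.inl b)) := rfl
        rw [h1, h2, map_add, map_add]
        exact add_add_add_comm _ _ _ _
      map_smul' := by
        intro c z
        have h1 : (fun b => (c • z) (Sum.inr b)) = c • (fun b : G.ι 0 => z (Sum.inr b)) := rfl
        have h2 : (fun b => (c • z) (Sum.inl b)) = c • (fun b : F.ι 1 => z (Sum.inl b)) := rfl
        rw [h1, h2, map_smul, map_smul]
        exact (smul_add _ _ _).symm }
  | i + 1 =>
    { toFun := fun z : F.ι (i + 2) ⊕ G.ι (i + 1) → Poly k n =>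
        Sum.elim
          (ψ.map (i + 1) (fun b => z (Sum.inr b)) + F.d (i + 1) (fun b => z (Sum.inl b)))
          (-(G.d i (fun b => z (Sum.inr b))))
      map_add' := by
        intro z z'
        have h1 : (fun b => (z + z') (Sum.inr b)) =
          (fun b => z (Sum.inr b)) + (fun b : G.ι (i + 1) => z' (Sum.inr b)) := rfl
        have h2 : (fun b => (z + z') (Sum.inl b)) =
          (fun b => z (Sum.inl b)) + (fun b : F.ι (i + 2) => z' (Sum.inl b)) := rfl
        rw [h1, h2, map_add, map_add, map_add]
        funext b
        rcases b with b | b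
        · exact add_add_add_comm _ _ _ _
        · exact neg_add _ _
      map_smul' := by
        intro c z
        have h1 : (fun b => (c • z) (Sum.inr b)) =
          c • (fun b : G.ι (i + 1) => z (Sum.inr b)) := rfl
        have h2 : (fun b => (c • z) (Sum.inl b)) =
          c • (fun b : F.ι (i + 2) => z (Sum.inl b)) := rfl
        rw [h1, h2, map_smul, map_smul, map_smul]
        funext b
        rcases b with b | b
        · exact (mul_add _ _ _).symm
        · exact (mul_neg _ _).symm }

/-- The mapping cone of a graded homomorphism of complexes `ψ : G → F`. -/
def cone {F G : GradedComplex k n} (ψ : Hom G F) : GradedComplex k n where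
  ι := coneι F G
  fin := by
    rintro (_ | i)
    · exact F.fin 0
    · have := F.fin (i + 1)
      have := G.fin i
      exact inferInstanceAs (Finite (F.ι (i + 1) ⊕ G.ι i))
  deg := coneDeg F G
  d := coneD ψ
  d_deg := by
    rintro (_ | i) e z hz b
    · exact Submodule.add_mem _
        (ψ.map_deg 0 e _ (fun c => hz (Sum.inr c)) b)
        (F.d_deg 0 e _ (fun c => hz (Sum.inl c)) b)
    · rcases b with b | b
      · exact Submodule.add_mem _
          (ψ.map_deg (i + 1) e _ (fun c => hz (Sum.inr c)) b)
          (F.d_deg (i + 1) e _ (fun c => hz (Sum.inl c)) b)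
      · exact Submodule.neg_mem _ (G.d_deg i e _ (fun c => hz (Sum.inr c)) b)
  d_comp_d := by
    rintro (_ | i) z
    · change ψ.map 0 (-(G.d 0 (fun b => z (Sum.inr b)))) +
        F.d 0 (ψ.map 1 (fun b => z (Sum.inr b)) + F.d 1 (fun b => z (Sum.inl b))) = 0
      rw [map_add, F.d_comp_d, ψ.comm, map_neg]
      simp
    · funext b
      rcases b with b | b
      · change (ψ.map (i + 1) (-(G.d (i + 1) (fun b => z (Sum.inr b)))) +
          F.d (i + 1) (ψ.map (i + 2) (fun b => z (Sum.inr b)) +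
            F.d (i + 2) (fun b => z (Sum.inl b)))) b = 0
        rw [map_add, F.d_comp_d, ψ.comm, map_neg]
        simp
      · change (-(G.d i (-(G.d (i + 1) (fun b => z (Sum.inr b)))))) b = 0
        rw [map_neg, G.d_comp_d]
        simp

/-- The augmentation of the mapping cone: the composite `M_0 = F_0 → R/A → R/B`, where
`A ⊆ B`. -/
def coneAug {F G : GradedComplex k n} (ψ : Hom G F) {A B : Ideal (Poly k n)} (h : A ≤ B)
    (ε : F.Mod 0 →ₗ[Poly k n] (Poly k n ⧸ A)) :
    (cone ψ).Mod 0 →ₗ[Poly k n] (Poly k n ⧸ B) :=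
  (Submodule.mapQ A B LinearMap.id h).comp ε

end GradedComplex

open GradedComplex

section Cones

variable {k : Type u} [Field k] {n : ℕ}

/-- `IteratedCone f a J F₀ ε₀ t A F ε`: the complex `F`, with augmentation `ε : F_0 → R/A`,
is obtained by `t` successive mapping cones from the complex `F₀`, with augmentation
`ε₀ : (F₀)_0 → R/J`, by adding the elements `f 0, …, f (t-1)` (of degrees
`a 0, …, a (t-1)`) to the ideal `J`. In step `t` one has `A = J + (f 0, …, f (t-1))` and the
complex `F`, one takes a minimal graded free resolution `G` of `R/(A : f t)`, shifted by
`a t`, and a graded homomorphism of complexes `ψ : G → F` which lifts the multiplication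
`R/(A : f t) → R/A` by `f t`, and one replaces `F` by the mapping cone of `ψ`
and `A` by `A + (f t)`. -/
inductive IteratedCone {m : ℕ} (f : Fin m → Poly k n) (a : Fin m → ℕ) (J : Ideal (Poly k n))
    (F₀ : GradedComplex k n) (ε₀ : F₀.Mod 0 →ₗ[Poly k n] (Poly k n ⧸ J)) :
    ℕ → (A : Ideal (Poly k n)) → (F : GradedComplex k n) →
      (F.Mod 0 →ₗ[Poly k n] (Poly k n ⧸ A)) → Prop
  | start : IteratedCone f a J F₀ ε₀ 0 J F₀ ε₀
  | step (t : Fin m) (A : Ideal (Poly k n)) (F : GradedComplex k n)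
      (ε : F.Mod 0 →ₗ[Poly k n] (Poly k n ⧸ A))
      (hF : IteratedCone f a J F₀ ε₀ (t : ℕ) A F ε)
      (G : GradedComplex k n)
      (η : G.Mod 0 →ₗ[Poly k n] (Poly k n ⧸ (A.colon {f t} : Ideal (Poly k n))))
      (hG : G.IsMinRes (quotPiece (A.colon {f t}) (a t)) η)
      (ψ : Hom G F)
      (hψ : ∀ y : G.Mod 0, ε (ψ.map 0 y) = mulMap A (f t) (η y))
      (B : Ideal (Poly k n)) (hB : B = A ⊔ Ideal.span {f t}) :
      IteratedCone f a J F₀ ε₀ ((t : ℕ) + 1) B (cone ψ)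
        (coneAug ψ (le_sup_left.trans hB.ge) ε)

/-- The graded Betti number `β_{i,j}(M)` of a finitely generated graded module `M` with graded
pieces `gr`: the number of basis elements of degree `j` in the `i`-th module of a minimal graded
free resolution of `M` (the set below has exactly one element, since minimal graded free
resolutions exist and are unique up to isomorphism), and `0` for `i < 0`. -/
def gradedBetti {M : Type v} [AddCommGroup M] [Module (Poly k n) M] [Module k M]
    [IsScalarTower k (Poly k n) M]
    (gr : ℤ → Submodule k M) (i j : ℤ) : ℕ :=
  if i < 0 then 0 else
    sInf {c : ℕ | ∃ (F : GradedComplex k n) (ε : F.Mod 0 →ₗ[Poly k n] M),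
      F.IsMinRes gr ε ∧ c = F.count i.toNat j}

/-- `β_{i,j}(R/A)`, for the standard grading of `R/A`. -/
def quotBetti (A : Ideal (Poly k n)) (i j : ℤ) : ℕ :=
  gradedBetti (k := k) (n := n) (quotPiece A 0) i j

end Cones

end MonomialCone

end

open MonomialCone MonomialCone.GradedComplex

noncomputable section

namespace MonomialCone

universe u v w

variable {k : Type u} [Field k] {n : ℕ}

/-! For a lift `ψ : G → F` of multiplication by `f`, the exact sequence 0 → R/(A : f) → R/A → R/(A +
(f)) → 0 makes the mapping cone a resolution of R/(A + (f)) (`isMinRes_cone`). The only issue is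
minimality, which holds once ψ has image in 𝔪F.

For f = x^a this comes from the hypothesis on minimal generators: a minimal generator of J divisible
by x^a must equal x^a. So either x^a ∈ J, or J : x^a = J : x^(a-1); this is `ColonStable`, obtained
in `colonStable_of_minGens_subset`. In the first case multiplication by x^a is zero. In the second
it is x times the map R/(J : x^a) → R/J given by x^(a-1). If φ lifts that map, then ψ and xφ lift
the same map, hence are homotopic; between minimal complexes a null-homotopic map has image in 𝔪F,
and so does xφ. Thus every choice of ψ works (`ColonStable.lift_mem`).

`ColonStable` survives colons and the addition of pure powers of other variables, so the argument
can be iterated. The bases of the cone give β(R/(A + (x^a))) = β(R/A) + shifted β(R/(A : x^a))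
(`quotBetti_sup_X_pow`). Since (J + P) : x^a = (J : x^a) + P when P is generated by powers of other
variables, induction on the set of powers yields the sum over subsets.

The dimension bound is independent of this: every prime containing I contains the m variables. The
remaining work is the existence of minimal graded resolutions, the comparison theorem, and the
uniqueness of the number of basis elements in each degree, without which `quotBetti` would not be
computed by the cone. -/

/-! ### Homogeneous components of polynomials and of graded free modules. -/

/-- The homogeneous component of degree `e ∈ ℤ` of a polynomial. -/
def polyComp (k : Type u) [Field k] (n : ℕ) (e : ℤ) : Poly k n →ₗ[k] Poly k n :=
  if 0 ≤ e then homogeneousComponent e.toNat else 0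

theorem coeff_polyComp (e : ℤ) (p : Poly k n) (s : Fin n →₀ ℕ) :
    coeff s (polyComp k n e p) = if (s.degree : ℤ) = e then coeff s p else 0 := by
  unfold polyComp
  split_ifs with h h' h'
  · rw [coeff_homogeneousComponent, if_pos (by omega)]
  · rw [coeff_homogeneousComponent, if_neg (by omega)]
  · omega
  · simp

theorem polyComp_mem (e : ℤ) (p : Poly k n) : polyComp k n e p ∈ polyPiece k n e := by
  intro s hs
  by_contra h
  exact hs (by rw [coeff_polyComp, if_neg h])

theorem polyComp_of_mem {e : ℤ} {p : Poly k n} (hp : p ∈ polyPiece k n e) :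
    polyComp k n e p = p := by
  ext s
  rw [coeff_polyComp]
  split_ifs with h
  · rfl
  · by_contra h'
    exact h (hp s (Ne.symm h'))

theorem polyComp_of_mem_ne {e e' : ℤ} {p : Poly k n} (hp : p ∈ polyPiece k n e) (h : e ≠ e') :
    polyComp k n e' p = 0 := by
  ext s
  rw [coeff_polyComp]
  split_ifs with h'
  · by_contra h2
    exact h ((hp s h2).symm.trans h')
  · simp

theorem mul_mem_polyPiece {e e' : ℤ} {p q : Poly k n} (hp : p ∈ polyPiece k n e)
    (hq : q ∈ polyPiece k n e') : p * q ∈ polyPiece k n (e + e') := by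
  intro s hs
  rw [coeff_mul] at hs
  obtain ⟨x, hx, hne⟩ := Finset.exists_ne_zero_of_sum_ne_zero hs
  rw [Finset.HasAntidiagonal.mem_antidiagonal] at hx
  rw [← hx, map_add, ← hp _ (left_ne_zero_of_mul hne), ← hq _ (right_ne_zero_of_mul hne)]
  push_cast
  rfl

theorem monomial_mem_polyPiece (s : Fin n →₀ ℕ) (c : k) :
    monomial s c ∈ polyPiece k n (s.degree : ℤ) := by
  classical
  intro t ht
  rw [coeff_monomial] at ht
  split_ifs at ht with h
  · rw [h]
  · exact absurd rfl ht

theorem one_mem_polyPiece : (1 : Poly k n) ∈ polyPiece k n 0 := by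
  simpa using monomial_mem_polyPiece (k := k) (0 : Fin n →₀ ℕ) 1

theorem C_mem_polyPiece (c : k) : (C c : Poly k n) ∈ polyPiece k n 0 := by
  simpa using monomial_mem_polyPiece (k := k) (0 : Fin n →₀ ℕ) c

theorem eq_C_of_mem_polyPiece_zero {p : Poly k n} (hp : p ∈ polyPiece k n 0) :
    p = C (constantCoeff p) := by
  classical
  ext s
  rw [coeff_C]
  split_ifs with h
  · rw [← h, constantCoeff_eq]
  · by_contra h'
    have := hp s h'
    apply h
    rw [eq_comm, ← Finsupp.degree_eq_zero_iff]
    exact_mod_cast this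

theorem constantCoeff_of_mem_polyPiece_ne {e : ℤ} {p : Poly k n} (hp : p ∈ polyPiece k n e)
    (he : e ≠ 0) : constantCoeff p = 0 := by
  by_contra h
  apply he
  rw [constantCoeff_eq] at h
  simpa using (hp 0 h).symm

theorem constantCoeff_polyComp_zero (p : Poly k n) :
    constantCoeff (polyComp k n 0 p) = constantCoeff p := by
  rw [constantCoeff_eq, coeff_polyComp]
  simp

/-- With `mem_maxIdeal_smul_top_iff`, this turns minimality of a complex into a test on constant
coefficients of coordinates. -/
theorem mem_maxIdeal_iff {p : Poly k n} : p ∈ maxIdeal k n ↔ constantCoeff p = 0 := by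
  have h : maxIdeal k n = idealOfVars (Fin n) k := rfl
  rw [h, ← pow_one (idealOfVars (Fin n) k), mem_pow_idealOfVars_iff', constantCoeff_eq]
  constructor
  · intro hp
    exact hp 0 (by simp)
  · intro hp s hs
    have : s = 0 := by
      rw [← Finsupp.degree_eq_zero_iff]; omega
    rw [this, hp]

/-- The degree `e` component in the graded free module `⨁ R(-deg b)`. -/
def freeComp {ι : Type} (k : Type u) [Field k] (n : ℕ) (deg : ι → ℤ) (e : ℤ) :
    (ι → Poly k n) →ₗ[k] (ι → Poly k n) :=
  LinearMap.pi fun b => (polyComp k n (e - deg b)).comp (LinearMap.proj b)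

theorem freeComp_apply {ι : Type} (deg : ι → ℤ) (e : ℤ) (x : ι → Poly k n) (b : ι) :
    freeComp k n deg e x b = polyComp k n (e - deg b) (x b) := rfl

/-- `x` is homogeneous of degree `e` in the graded free module `⨁ R(-deg b)`. -/
def freePiece {ι : Type} (k : Type u) [Field k] (n : ℕ) (deg : ι → ℤ) (e : ℤ) :
    Submodule k (ι → Poly k n) where
  carrier := {x | ∀ b, x b ∈ polyPiece k n (e - deg b)}
  zero_mem' := fun _ => Submodule.zero_mem _
  add_mem' := fun hx hy b => Submodule.add_mem _ (hx b) (hy b)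
  smul_mem' := fun c _ hx b => Submodule.smul_mem _ c (hx b)

/-- `π e` is the projection of a graded module onto its piece of degree `e`. -/
structure IsGradedProj {M : Type v} [AddCommGroup M] [Module k M] (gr : ℤ → Submodule k M)
    (π : ℤ → M →+ M) : Prop where
  mem : ∀ e x, π e x ∈ gr e
  self : ∀ e x, x ∈ gr e → π e x = x
  ne : ∀ e e' x, x ∈ gr e → e ≠ e' → π e' x = 0

theorem freeComp_mem {ι : Type} (deg : ι → ℤ) (e : ℤ) (x : ι → Poly k n) :
    freeComp k n deg e x ∈ freePiece k n deg e := fun _ => polyComp_mem _ _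

theorem isGradedProj_freeComp {ι : Type} (deg : ι → ℤ) :
    IsGradedProj (freePiece k n deg) (fun e => (freeComp k n deg e).toAddMonoidHom) where
  mem e x := freeComp_mem deg e x
  self e x hx := by
    funext b
    exact polyComp_of_mem (hx b)
  ne e e' x hx h := by
    funext b
    exact polyComp_of_mem_ne (hx b) (by omega)

theorem exists_sum_freeComp {ι : Type} [Finite ι] (deg : ι → ℤ) (x : ι → Poly k n) :
    ∃ E : Finset ℤ, x = ∑ e ∈ E, freeComp k n deg e x ∧
      ∀ e ∉ E, freeComp k n deg e x = 0 := by
  classical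
  have := Fintype.ofFinite ι
  -- The set of all degrees of terms occurring in `x`: a term of exponent `s` at `b` has degree `|s|
  -- + deg b`.
  refine ⟨Finset.univ.biUnion fun b => (x b).support.image fun s => (s.degree : ℤ) + deg b,
    ?_, ?_⟩
  · funext b
    rw [Finset.sum_apply]
    ext s
    rw [coeff_sum]
    simp only [freeComp_apply, coeff_polyComp]
    by_cases h : coeff s (x b) = 0
    · simp [h]
    · rw [Finset.sum_eq_single ((s.degree : ℤ) + deg b)]
      · simp
      · intro e _ he
        rw [if_neg (by omega)]
      · intro h'
        refine absurd ?_ h'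
        simp only [Finset.mem_biUnion, Finset.mem_univ, true_and, Finset.mem_image]
        exact ⟨b, s, mem_support_iff.mpr h, rfl⟩
  · intro e he
    funext b
    ext s
    rw [freeComp_apply, coeff_polyComp]
    split_ifs with h
    · by_contra h'
      apply he
      simp only [Finset.mem_biUnion, Finset.mem_univ, true_and, Finset.mem_image]
      exact ⟨b, s, mem_support_iff.mpr h', by omega⟩
    · simp

/-- Maps of degree `0` commute with the projections onto the homogeneous pieces. -/
theorem IsGradedProj.map_freeComp {M : Type v} [AddCommGroup M] [Module k M]
    {gr : ℤ → Submodule k M} {π : ℤ → M →+ M} (hπ : IsGradedProj gr π)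
    {ι : Type} [Finite ι] {deg : ι → ℤ} {F : Type*} [FunLike F (ι → Poly k n) M]
    [AddMonoidHomClass F (ι → Poly k n) M] (g : F)
    (hg : ∀ e, ∀ x ∈ freePiece k n deg e, g x ∈ gr e) (e : ℤ) (x : ι → Poly k n) :
    π e (g x) = g (freeComp k n deg e x) := by
  obtain ⟨E, hE, hE'⟩ := exists_sum_freeComp deg x
  conv_lhs => rw [hE, map_sum, map_sum]
  by_cases he : e ∈ E
  · rw [Finset.sum_eq_single_of_mem e he]
    · exact hπ.self _ _ (hg _ _ (freeComp_mem deg e x))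
    · intro e' _ h
      exact hπ.ne e' e _ (hg _ _ (freeComp_mem deg e' x)) h
  · rw [hE' e he, map_zero]
    refine Finset.sum_eq_zero fun e' h' => ?_
    exact hπ.ne e' e _ (hg _ _ (freeComp_mem deg e' x)) (fun h => he (h ▸ h'))

/-- A homogeneous element of the range of a map of degree `0` has a homogeneous preimage. -/
theorem IsGradedProj.exists_homogeneous_preimage {M : Type v} [AddCommGroup M] [Module k M]
    {gr : ℤ → Submodule k M} {π : ℤ → M →+ M} (hπ : IsGradedProj gr π)
    {ι : Type} [Finite ι] {deg : ι → ℤ} {F : Type*} [FunLike F (ι → Poly k n) M]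
    [AddMonoidHomClass F (ι → Poly k n) M] (g : F)
    (hg : ∀ e, ∀ x ∈ freePiece k n deg e, g x ∈ gr e) {e : ℤ} {y : M} (hy : y ∈ gr e)
    (h : ∃ x, g x = y) : ∃ x ∈ freePiece k n deg e, g x = y := by
  obtain ⟨x, rfl⟩ := h
  exact ⟨freeComp k n deg e x, freeComp_mem deg e x, by
    rw [← hπ.map_freeComp g hg, hπ.self _ _ hy]⟩

/-- A linear map maps `𝔪 F` into `𝔪 F'`. -/
theorem map_mem_maxIdeal_smul_top {M N : Type*} [AddCommGroup M] [AddCommGroup N]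
    [Module (Poly k n) M] [Module (Poly k n) N] (g : M →ₗ[Poly k n] N) {x : M}
    (hx : x ∈ maxIdeal k n • (⊤ : Submodule (Poly k n) M)) :
    g x ∈ maxIdeal k n • (⊤ : Submodule (Poly k n) N) := by
  have h : g x ∈ (maxIdeal k n • (⊤ : Submodule (Poly k n) M)).map g := ⟨x, hx, rfl⟩
  rw [Submodule.map_smul''] at h
  exact Submodule.smul_mono le_rfl le_top h

theorem mem_maxIdeal_smul_top_iff {ι : Type} [Finite ι] {x : ι → Poly k n} :
    x ∈ maxIdeal k n • (⊤ : Submodule (Poly k n) (ι → Poly k n)) ↔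
      ∀ b, constantCoeff (x b) = 0 := by
  classical
  have := Fintype.ofFinite ι
  constructor
  · intro hx b
    rw [← mem_maxIdeal_iff]
    simpa using map_mem_maxIdeal_smul_top (LinearMap.proj b : (ι → Poly k n) →ₗ[Poly k n] _) hx
  · intro hx
    rw [← Finset.univ_sum_single x]
    refine Submodule.sum_mem _ fun b _ => ?_
    have : (Pi.single b (x b) : ι → Poly k n) = x b • Pi.single b 1 := by
      rw [← Pi.single_smul, smul_eq_mul, mul_one]
    rw [this]
    exact Submodule.smul_mem_smul (mem_maxIdeal_iff.mpr (hx b)) trivial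

/-! ### Existence of minimal graded free resolutions. -/

/-- A graded submodule, contained in `𝔪 E`, of a graded free module `E` of finite rank. -/
structure GradedSub (k : Type u) [Field k] (n : ℕ) where
  N : ℕ
  deg : Fin N → ℤ
  K : Submodule (Poly k n) (Fin N → Poly k n)
  homog : ∀ x ∈ K, ∀ e, freeComp k n deg e x ∈ K
  le : K ≤ maxIdeal k n • ⊤

/-- By noetherianity there are finitely many generators; their finitely many homogeneous components
still lie in the submodule, as it is graded, and generate it. -/
theorem exists_homogeneous_generators (s : GradedSub k n) :
    ∃ (N : ℕ) (g : Fin N → (Fin s.N → Poly k n)),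
      (∀ b, ∃ e, g b ∈ freePiece k n s.deg e) ∧
        Submodule.span (Poly k n) (Set.range g) = s.K := by
  classical
  obtain ⟨S, hS⟩ := (IsNoetherian.noetherian s.K : s.K.FG)
  choose E hE _ using fun x : Fin s.N → Poly k n => exists_sum_freeComp s.deg x
  let T : Finset (Fin s.N → Poly k n) :=
    S.biUnion fun x => (E x).image fun e => freeComp k n s.deg e x
  refine ⟨T.card, fun b => (T.equivFin.symm b : Fin s.N → Poly k n), fun b => ?_, ?_⟩
  · have := (T.equivFin.symm b).2
    simp only [T, Finset.mem_biUnion, Finset.mem_image] at this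
    obtain ⟨x, -, e, -, h⟩ := this
    refine ⟨e, ?_⟩
    change (T.equivFin.symm b : Fin s.N → Poly k n) ∈ _
    rw [← h]
    exact freeComp_mem s.deg e x
  · have hr : Set.range (fun b => (T.equivFin.symm b : Fin s.N → Poly k n)) = (T : Set _) := by
      ext x
      constructor
      · rintro ⟨b, rfl⟩
        exact (T.equivFin.symm b).2
      · intro hx
        exact ⟨T.equivFin ⟨x, hx⟩, by simp⟩
    rw [hr]
    apply le_antisymm
    · rw [Submodule.span_le]
      intro y hy
      simp only [T, Finset.coe_biUnion, Finset.coe_image, Set.mem_iUnion, Set.mem_image] at hy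
      obtain ⟨x, hx, e, -, rfl⟩ := hy
      exact s.homog x (hS ▸ Submodule.subset_span hx) e
    · rw [← hS, Submodule.span_le]
      intro x hx
      rw [SetLike.mem_coe, hE x]
      refine Submodule.sum_mem _ fun e he => Submodule.subset_span ?_
      simp only [T, Finset.coe_biUnion, Finset.coe_image, Set.mem_iUnion, Set.mem_image]
      exact ⟨x, hx, e, he, rfl⟩

/-- A graded submodule is the image of a minimal free cover. -/
theorem exists_minimal_cover (s : GradedSub k n) :
    ∃ (t : GradedSub k n) (d : (Fin t.N → Poly k n) →ₗ[Poly k n] (Fin s.N → Poly k n)),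
      (∀ e, ∀ x ∈ freePiece k n t.deg e, d x ∈ freePiece k n s.deg e) ∧
        LinearMap.range d = s.K ∧ LinearMap.ker d = t.K := by
  classical
  -- The least possible number of homogeneous generators is taken: this forces the kernel of the
  -- cover into 𝔪.
  have hex := exists_homogeneous_generators s
  obtain ⟨g, hg, hspan⟩ := Nat.find_spec hex
  have hmin := fun N => Nat.find_min hex (m := N)
  generalize Nat.find hex = N at g hmin
  choose deg hdeg using hg
  let d : (Fin N → Poly k n) →ₗ[Poly k n] (Fin s.N → Poly k n) :=
    Fintype.linearCombination (Poly k n) g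
  have hd : ∀ x, d x = ∑ b, x b • g b := fun x => Fintype.linearCombination_apply _ _ _
  have hgr : ∀ e, ∀ x ∈ freePiece k n deg e, d x ∈ freePiece k n s.deg e := by
    intro e x hx c
    rw [hd, Finset.sum_apply]
    refine Submodule.sum_mem _ fun b _ => ?_
    have := mul_mem_polyPiece (hx b) (hdeg b c)
    rwa [show e - deg b + (deg b - s.deg c) = e - s.deg c by ring] at this
  have hker : ∀ x ∈ LinearMap.ker d, ∀ e, freeComp k n deg e x ∈ LinearMap.ker d := by
    intro x hx e
    rw [LinearMap.mem_ker] at hx ⊢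
    rw [← (isGradedProj_freeComp s.deg).map_freeComp d hgr, hx, map_zero]
  refine ⟨⟨N, deg, LinearMap.ker d, hker, ?_⟩, d, hgr, ?_, rfl⟩
  · intro z hz
    rw [mem_maxIdeal_smul_top_iff]
    intro b
    by_contra hb
    have hz' := hker z hz (deg b)
    set z' := freeComp k n deg (deg b) z with hz'_def
    -- In the component of degree `deg b`, the entry at `b` has degree 0, so here it is a nonzero
    -- constant. The relation `z'` can then be solved for `g b`, and one generator fewer would
    -- suffice.
    have hzb : z' b = C (constantCoeff (z b)) := by
      have h0 : z' b = polyComp k n 0 (z b) := by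
        rw [hz'_def, freeComp_apply, sub_self]
      rw [h0, eq_C_of_mem_polyPiece_zero (polyComp_mem 0 (z b)), constantCoeff_polyComp_zero]
    obtain _ | M := N
    · exact b.elim0
    refine hmin M (Nat.lt_succ_self M) ⟨fun c => g (b.succAbove c),
      fun c => ⟨_, hdeg (b.succAbove c)⟩, ?_⟩
    rw [← hspan]
    apply le_antisymm
    · apply Submodule.span_mono
      rintro _ ⟨c, rfl⟩
      exact ⟨_, rfl⟩
    · rw [Submodule.span_le]
      have hmem : ∀ c, g (b.succAbove c) ∈
          Submodule.span (Poly k n) (Set.range fun c => g (b.succAbove c)) :=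
        fun c => Submodule.subset_span ⟨c, rfl⟩
      rintro _ ⟨c, rfl⟩
      obtain rfl | ⟨c, rfl⟩ := Fin.eq_self_or_eq_succAbove b c
      · rw [LinearMap.mem_ker, hd, Fin.sum_univ_succAbove _ c, hzb] at hz'
        have h1 : g c = (C (constantCoeff (z c))⁻¹ : Poly k n) •
            (C (constantCoeff (z c)) : Poly k n) • g c := by
          rw [smul_smul, ← C_mul, inv_mul_cancel₀ hb, C_1, one_smul]
        rw [SetLike.mem_coe, h1, eq_neg_of_add_eq_zero_left hz']
        exact Submodule.smul_mem _ _ (Submodule.neg_mem _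
          (Submodule.sum_mem _ fun c' _ => Submodule.smul_mem _ _ (hmem c')))
      · exact hmem c
  · exact (Fintype.range_linearCombination _ _).trans hspan

/-- The minimal free cover of a graded submodule, with its kernel. -/
def GradedSub.next (s : GradedSub k n) : GradedSub k n := (exists_minimal_cover s).choose

/-- The minimal free cover of a graded submodule. -/
def GradedSub.coverMap (s : GradedSub k n) :
    (Fin s.next.N → Poly k n) →ₗ[Poly k n] (Fin s.N → Poly k n) :=
  (exists_minimal_cover s).choose_spec.choose

theorem GradedSub.coverMap_spec (s : GradedSub k n) :
    (∀ e, ∀ x ∈ freePiece k n s.next.deg e, s.coverMap x ∈ freePiece k n s.deg e) ∧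
        LinearMap.range s.coverMap = s.K ∧ LinearMap.ker s.coverMap = s.next.K :=
  (exists_minimal_cover s).choose_spec.choose_spec

/-- The successive syzygies of a graded submodule. -/
def GradedSub.syz (s : GradedSub k n) : ℕ → GradedSub k n
  | 0 => s
  | i + 1 => (s.syz i).next

/-- The complex obtained by iterating minimal free covers. -/
def GradedSub.complex (s : GradedSub k n) : GradedComplex k n where
  ι i := Fin (s.syz i).N
  fin _ := inferInstance
  deg i := (s.syz i).deg
  d i := (s.syz i).coverMap
  d_deg i e x hx := (s.syz i).coverMap_spec.1 e x hx
  d_comp_d i x := by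
    have h : (s.syz (i + 1)).coverMap x ∈ LinearMap.ker (s.syz i).coverMap := by
      rw [(s.syz i).coverMap_spec.2.2]
      change (s.syz (i + 1)).coverMap x ∈ (s.syz (i + 1)).K
      rw [← (s.syz (i + 1)).coverMap_spec.2.1]
      exact ⟨x, rfl⟩
    exact h

theorem GradedSub.isMinRes_complex (s : GradedSub k n) {M : Type v} [AddCommGroup M]
    [Module (Poly k n) M] [Module k M] [IsScalarTower k (Poly k n) M]
    (gr : ℤ → Submodule k M) (ε : (Fin s.N → Poly k n) →ₗ[Poly k n] M)
    (hgr : ∀ e, ∀ x ∈ freePiece k n s.deg e, ε x ∈ gr e) (hε : Function.Surjective ε)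
    (hker : LinearMap.ker ε = s.K) : s.complex.IsMinRes gr ε where
  graded e x hx := hgr e x hx
  surjective := hε
  exact_zero := LinearMap.exact_iff.mpr (hker.trans s.coverMap_spec.2.1.symm)
  exact_succ i := LinearMap.exact_iff.mpr <|
    (s.syz i).coverMap_spec.2.2.trans (s.syz (i + 1)).coverMap_spec.2.1.symm
  minimal i := (s.syz i).coverMap_spec.2.1.le.trans (s.syz i).le

/-- `A` is a homogeneous ideal. -/
def IsHomogIdeal (A : Ideal (Poly k n)) : Prop := ∀ p ∈ A, ∀ e, polyComp k n e p ∈ A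

/-- A proper homogeneous ideal lies in 𝔪, so R → R/A starts a minimal resolution. For A = R the
kernel of this map is not in 𝔪, and the resolution has to start from a module of rank 0. -/
theorem exists_isMinRes {A : Ideal (Poly k n)} (hA : IsHomogIdeal A) (c : ℤ) :
    ∃ (F : GradedComplex k n) (ε : F.Mod 0 →ₗ[Poly k n] (Poly k n ⧸ A)),
      F.IsMinRes (quotPiece A c) ε := by
  by_cases h1 : (1 : Poly k n) ∈ A
  · have hsub : Subsingleton (Poly k n ⧸ A) :=
      Ideal.Quotient.subsingleton_iff.mpr ((Ideal.eq_top_iff_one _).mpr h1)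
    let s : GradedSub k n := ⟨0, Fin.elim0, ⊤, fun _ _ _ => trivial, fun x _ => by
      rw [Subsingleton.elim x 0]; exact Submodule.zero_mem _⟩
    refine ⟨s.complex, (0 : (Fin 0 → Poly k n) →ₗ[Poly k n] _), s.isMinRes_complex _ _ ?_ ?_ ?_⟩
    · intro e x _
      exact Submodule.zero_mem _
    · intro y
      exact ⟨0, Subsingleton.elim _ _⟩
    · exact LinearMap.ker_zero
  · let ε : (Fin 1 → Poly k n) →ₗ[Poly k n] (Poly k n ⧸ A) :=
      (Submodule.mkQ A).comp (LinearMap.proj 0)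
    have hε : ∀ x, x ∈ LinearMap.ker ε ↔ x 0 ∈ A := fun x => Ideal.Quotient.eq_zero_iff_mem
    let s : GradedSub k n := ⟨1, fun _ => c, LinearMap.ker ε, fun x hx e => by
      rw [hε] at hx ⊢
      exact hA _ hx _, fun x hx => by
      rw [hε] at hx
      rw [mem_maxIdeal_smul_top_iff]
      intro b
      rw [Subsingleton.elim b 0]
      -- A nonzero constant term is itself in `A`, being the degree 0 component, and is a unit.
      by_contra hb
      have h0 := hA _ hx 0
      rw [eq_C_of_mem_polyPiece_zero (polyComp_mem 0 (x 0)), constantCoeff_polyComp_zero] at h0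
      apply h1
      have := A.mul_mem_left (C (constantCoeff (x 0))⁻¹) h0
      rwa [← C_mul, inv_mul_cancel₀ hb, C_1] at this⟩
    refine ⟨s.complex, ε, s.isMinRes_complex _ ε ?_ ?_ rfl⟩
    · intro e x hx
      exact ⟨x 0, hx 0, rfl⟩
    · intro y
      obtain ⟨p, rfl⟩ := Ideal.Quotient.mk_surjective y
      exact ⟨fun _ => p, rfl⟩

/-! ### Comparison of complexes. -/

/-- The recursion scheme for chain maps and homotopies: `P` is the invariant that allows the next
map to be chosen, `Q` the compatibility of consecutive maps. -/
theorem exists_dependent_seq {α : ℕ → Type*} (P : ∀ i, α i → Prop)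
    (Q : ∀ i, α i → α (i + 1) → Prop) (h0 : ∃ x, P 0 x)
    (hs : ∀ i x, P i x → ∃ y, P (i + 1) y ∧ Q i x y) :
    ∃ f : ∀ i, α i, P 0 (f 0) ∧ ∀ i, P i (f i) ∧ Q i (f i) (f (i + 1)) := by
  choose nx hnx using hs
  obtain ⟨x0, hx0⟩ := h0
  let f : ∀ i, {x : α i // P i x} := fun i =>
    Nat.rec (motive := fun i => {x : α i // P i x}) ⟨x0, hx0⟩
      (fun i x => ⟨nx i x.1 x.2, (hnx i x.1 x.2).1⟩) i
  exact ⟨fun i => (f i).1, hx0, fun i => ⟨(f i).2, (hnx i (f i).1 (f i).2).2⟩⟩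

theorem exists_linearMap_lift {M : Type v} [AddCommGroup M] [Module (Poly k n) M]
    {ι κ : Type} [Finite κ] (u : (ι → Poly k n) →ₗ[Poly k n] M)
    (z : (κ → Poly k n) →ₗ[Poly k n] M) (h : ∀ y, ∃ x, u x = z y) :
    ∃ φ : (κ → Poly k n) →ₗ[Poly k n] (ι → Poly k n), ∀ y, u (φ y) = z y := by
  classical
  have := Fintype.ofFinite κ
  choose x hx using fun b : κ => h (Pi.single b 1)
  refine ⟨Fintype.linearCombination (Poly k n) x, ?_⟩
  have : u ∘ₗ Fintype.linearCombination (Poly k n) x = z := by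
    apply LinearMap.pi_ext'
    intro b
    ext
    simp [hx]
  exact fun y => LinearMap.congr_fun this y

/-- The basis element at `b` is homogeneous of degree `deg' b`, so its image has a preimage of that
degree; extending these choices linearly gives a map of degree 0. -/
theorem exists_graded_linearMap_lift {M : Type v} [AddCommGroup M] [Module (Poly k n) M]
    [Module k M] {gr : ℤ → Submodule k M} {π : ℤ → M →+ M} (hπ : IsGradedProj gr π)
    {ι κ : Type} [Finite ι] [Finite κ] {deg : ι → ℤ} {deg' : κ → ℤ}
    (u : (ι → Poly k n) →ₗ[Poly k n] M) (hu : ∀ e, ∀ x ∈ freePiece k n deg e, u x ∈ gr e)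
    (z : (κ → Poly k n) →ₗ[Poly k n] M) (hz : ∀ e, ∀ x ∈ freePiece k n deg' e, z x ∈ gr e)
    (h : ∀ y, ∃ x, u x = z y) :
    ∃ φ : (κ → Poly k n) →ₗ[Poly k n] (ι → Poly k n),
      (∀ e, ∀ y ∈ freePiece k n deg' e, φ y ∈ freePiece k n deg e) ∧ ∀ y, u (φ y) = z y := by
  classical
  have := Fintype.ofFinite κ
  have hb : ∀ b : κ, ∃ x ∈ freePiece k n deg (deg' b), u x = z (Pi.single b 1) := by
    intro b
    refine hπ.exists_homogeneous_preimage u hu (hz _ _ ?_) (h _)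
    intro c
    by_cases hc : c = b
    · subst hc
      simpa using one_mem_polyPiece
    · rw [Pi.single_eq_of_ne hc]
      exact Submodule.zero_mem _
  choose x hx hx' using hb
  refine ⟨Fintype.linearCombination (Poly k n) x, ?_, ?_⟩
  · intro e y hy c
    rw [Fintype.linearCombination_apply, Finset.sum_apply]
    refine Submodule.sum_mem _ fun b _ => ?_
    have := mul_mem_polyPiece (hy b) (hx b c)
    rwa [show e - deg' b + (deg' b - deg c) = e - deg c by ring] at this
  · have : u ∘ₗ Fintype.linearCombination (Poly k n) x = z := by
      apply LinearMap.pi_ext'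
      intro b
      ext
      simp [hx']
    exact fun y => LinearMap.congr_fun this y

namespace GradedComplex

variable {M : Type v} [AddCommGroup M] [Module (Poly k n) M] [Module k M]
  [IsScalarTower k (Poly k n) M] {gr : ℤ → Submodule k M}
  {N : Type w} [AddCommGroup N] [Module (Poly k n) N]

/-- Comparison theorem, forgetting the gradings. -/
theorem IsMinRes.exists_lift {F : GradedComplex k n} {ε : F.Mod 0 →ₗ[Poly k n] M}
    (hF : F.IsMinRes gr ε) {G : GradedComplex k n} {η : G.Mod 0 →ₗ[Poly k n] N}
    (hη : ∀ y, η (G.d 0 y) = 0) (g : N →ₗ[Poly k n] M) :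
    ∃ φ : ∀ i, G.Mod i →ₗ[Poly k n] F.Mod i,
      (∀ y, ε (φ 0 y) = g (η y)) ∧ ∀ i y, F.d i (φ (i + 1) y) = φ i (G.d i y) := by
  have := F.fin
  have := G.fin
  -- The condition in degree `i + 1` says that `φ ∘ G.d` lands in the kernel of `F.d`, so that
  -- exactness provides the next lift.
  let P : ∀ i, (G.Mod i →ₗ[Poly k n] F.Mod i) → Prop
    | 0, φ => ∀ y, ε (φ y) = g (η y)
    | i + 1, φ => ∀ y, F.d i (φ (G.d (i + 1) y)) = 0
  obtain ⟨φ, h0, h⟩ := exists_dependent_seq P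
    (fun i φ φ' => ∀ y, F.d i (φ' y) = φ (G.d i y))
    (exists_linearMap_lift ε (g ∘ₗ η) fun y => hF.surjective _) (by
      intro i φ hφ
      have hex : ∀ y, ∃ x, F.d i x = (φ ∘ₗ G.d i) y := by
        intro y
        cases i with
        | zero =>
          refine (hF.exact_zero _).mp ?_
          change ε (φ (G.d 0 y)) = 0
          rw [hφ, hη, map_zero]
        | succ i => exact (hF.exact_succ i _).mp (hφ y)
      obtain ⟨φ', hφ'⟩ := exists_linearMap_lift (F.d i) (φ ∘ₗ G.d i) hex
      refine ⟨φ', fun y => ?_, hφ'⟩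
      rw [hφ']
      change φ (G.d i (G.d (i + 1) y)) = 0
      rw [G.d_comp_d, map_zero])
  exact ⟨φ, h0, fun i => (h i).2⟩

/-- Comparison theorem. -/
theorem IsMinRes.exists_hom {F : GradedComplex k n} {ε : F.Mod 0 →ₗ[Poly k n] M}
    (hF : F.IsMinRes gr ε) {π : ℤ → M →+ M} (hπ : IsGradedProj gr π)
    {G : GradedComplex k n} {z : G.Mod 0 →ₗ[Poly k n] M}
    (hz : ∀ y, z (G.d 0 y) = 0) (hgr : ∀ e y, G.IsHomog 0 e y → z y ∈ gr e) :
    ∃ ψ : Hom G F, ∀ y, ε (ψ.map 0 y) = z y := by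
  have := F.fin
  have := G.fin
  let P : ∀ i, (G.Mod i →ₗ[Poly k n] F.Mod i) → Prop
    | 0, φ => (∀ e y, G.IsHomog 0 e y → F.IsHomog 0 e (φ y)) ∧ ∀ y, ε (φ y) = z y
    | i + 1, φ => (∀ e y, G.IsHomog (i + 1) e y → F.IsHomog (i + 1) e (φ y)) ∧
        ∀ y, F.d i (φ (G.d (i + 1) y)) = 0
  have hP : ∀ i φ, P i φ → ∀ e y, G.IsHomog i e y → F.IsHomog i e (φ y) := by
    rintro (_ | i) φ h
    · exact h.1
    · exact h.1
  obtain ⟨φ, h0, h⟩ := exists_dependent_seq P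
    (fun i φ φ' => ∀ y, F.d i (φ' y) = φ (G.d i y))
    (exists_graded_linearMap_lift hπ ε hF.graded z hgr fun y => hF.surjective _) (by
      intro i φ hφ
      have hex : ∀ y, ∃ x, F.d i x = (φ ∘ₗ G.d i) y := by
        intro y
        cases i with
        | zero =>
          refine (hF.exact_zero _).mp ?_
          change ε (φ (G.d 0 y)) = 0
          rw [hφ.2, hz]
        | succ i => exact (hF.exact_succ i _).mp (hφ.2 y)
      obtain ⟨φ', hφ', hφ''⟩ := exists_graded_linearMap_lift
        (isGradedProj_freeComp (F.deg i)) (deg := F.deg (i + 1)) (deg' := G.deg (i + 1))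
        (F.d i) (F.d_deg i) (φ ∘ₗ G.d i)
        (fun e x hx => hP i φ hφ e _ (G.d_deg i e x hx)) hex
      refine ⟨φ', ⟨hφ', fun y => ?_⟩, hφ''⟩
      rw [hφ'']
      change φ (G.d i (G.d (i + 1) y)) = 0
      rw [G.d_comp_d, map_zero])
  exact ⟨⟨φ, fun i => hP i _ (h i).1, fun i => (h i).2⟩, h0.2⟩

/-- A chain map between minimal complexes which lifts the zero map is null-homotopic, hence has
image in `𝔪 F`. -/
theorem IsMinRes.lift_zero_mem {F : GradedComplex k n} {ε : F.Mod 0 →ₗ[Poly k n] M}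
    (hF : F.IsMinRes gr ε) {G : GradedComplex k n}
    (hG : ∀ i, LinearMap.range (G.d i) ≤
      maxIdeal k n • (⊤ : Submodule (Poly k n) (G.Mod i)))
    (δ : ∀ i, G.Mod i →ₗ[Poly k n] F.Mod i) (h0 : ∀ y, ε (δ 0 y) = 0)
    (hδ : ∀ i y, F.d i (δ (i + 1) y) = δ i (G.d i y)) (i : ℕ) (y : G.Mod i) :
    δ i y ∈ maxIdeal k n • (⊤ : Submodule (Poly k n) (F.Mod i)) := by
  have := F.fin
  have := G.fin
  have hd : ∀ i x, F.d i x ∈ maxIdeal k n • (⊤ : Submodule (Poly k n) (F.Mod i)) :=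
    fun i x => hF.minimal i ⟨x, rfl⟩
  -- A homotopy with δ = dh + hd is built degree by degree; the invariant says that δ - hd consists
  -- of cycles.
  obtain ⟨h, hh0, hh⟩ := exists_dependent_seq
    (α := fun i => G.Mod i →ₗ[Poly k n] F.Mod (i + 1))
    (fun i h => ∀ y, F.d i (δ (i + 1) y - h (G.d i y)) = 0)
    (fun i h h' => ∀ y, F.d (i + 1) (h' y) = δ (i + 1) y - h (G.d i y))
    (by
      obtain ⟨h, hh⟩ := exists_linearMap_lift (F.d 0) (δ 0)
        fun y => (hF.exact_zero _).mp (h0 y)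
      exact ⟨h, fun y => by rw [map_sub, hδ, hh, sub_self]⟩) (by
      intro i h hh
      obtain ⟨h', hh'⟩ := exists_linearMap_lift (F.d (i + 1)) (δ (i + 1) - h ∘ₗ G.d i)
        fun y => (hF.exact_succ i _).mp (hh y)
      refine ⟨h', fun y => ?_, hh'⟩
      rw [map_sub, hδ, hh']
      simp [G.d_comp_d])
  have key : ∀ i y, δ i y ∈ maxIdeal k n • (⊤ : Submodule (Poly k n) (F.Mod i)) := by
    rintro (_ | i) y
    · obtain ⟨x, hx⟩ := (hF.exact_zero _).mp (h0 y)
      rw [← hx]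
      exact hd 0 x
    -- Both terms of dh + hd lie in 𝔪F: the first because F is minimal, the second because G is.
    · have h1 := (hh i).2 y
      rw [eq_comm, sub_eq_iff_eq_add] at h1
      rw [h1]
      exact Submodule.add_mem _ (hd _ _)
        (map_mem_maxIdeal_smul_top (h i) (hG i ⟨y, rfl⟩))
  exact key i y

/-- A chain map between minimal complexes which lifts a multiple of a module map by an element
of `𝔪` has image in `𝔪 F`. -/
theorem IsMinRes.lift_smul_mem {F : GradedComplex k n} {ε : F.Mod 0 →ₗ[Poly k n] M}
    (hF : F.IsMinRes gr ε) {G : GradedComplex k n} {η : G.Mod 0 →ₗ[Poly k n] N}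
    (hη : ∀ y, η (G.d 0 y) = 0)
    (hG : ∀ i, LinearMap.range (G.d i) ≤
      maxIdeal k n • (⊤ : Submodule (Poly k n) (G.Mod i)))
    (ψ : Hom G F) (g : N →ₗ[Poly k n] M) {p : Poly k n} (hp : p ∈ maxIdeal k n)
    (hψ : ∀ y, ε (ψ.map 0 y) = p • g (η y)) (i : ℕ) (y : G.Mod i) :
    ψ.map i y ∈ maxIdeal k n • (⊤ : Submodule (Poly k n) (F.Mod i)) := by
  -- As φ lifts `g`, the difference ψ - pφ lifts zero, and pφ is visibly in 𝔪F. No grading is needed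
  -- on φ.
  obtain ⟨φ, h0, hφ⟩ := hF.exists_lift hη g
  have h := hF.lift_zero_mem hG (fun i => ψ.map i - p • φ i)
    (fun y => by simp [hψ, h0])
    (fun i y => by simp [ψ.comm, hφ]) i y
  have h2 : ψ.map i y = (ψ.map i - p • φ i) y + p • φ i y := by simp
  rw [h2]
  exact Submodule.add_mem _ h (Submodule.smul_mem_smul hp trivial)

/-! ### Uniqueness of graded Betti numbers. -/

/-- Lifts φ, φ' of the identity in both directions satisfy φ'φ ≡ id modulo 𝔪. Hence φ induces an
injection on the degree `j` parts of F/𝔪F and F'/𝔪F', whose dimensions are the two counts. -/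
theorem IsMinRes.count_le {F F' : GradedComplex k n} {ε : F.Mod 0 →ₗ[Poly k n] M}
    {ε' : F'.Mod 0 →ₗ[Poly k n] M} (hF : F.IsMinRes gr ε) (hF' : F'.IsMinRes gr ε')
    {π : ℤ → M →+ M} (hπ : IsGradedProj gr π) (i : ℕ) (j : ℤ) :
    F.count i j ≤ F'.count i j := by
  classical
  have := F.fin
  have := F'.fin
  obtain ⟨φ, hφ⟩ := hF'.exists_hom hπ (z := ε) (fun y => hF.exact_zero.apply_apply_eq_zero y)
    hF.graded
  obtain ⟨φ', hφ'⟩ := hF.exists_hom hπ (z := ε') (fun y => hF'.exact_zero.apply_apply_eq_zero y)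
    hF'.graded
  have key := hF.lift_zero_mem hF.minimal (fun i => φ'.map i ∘ₗ φ.map i - LinearMap.id)
    (fun y => by simp [hφ, hφ']) (fun i y => by simp [φ.comm, φ'.comm]) i
  -- A representative in F of a vector of the degree `j` part of F/𝔪F: constants at the basis
  -- elements of degree `j`, zero elsewhere.
  let ext : ({b : F.ι i // F.deg i b = j} → k) → F.Mod i := fun c b =>
    if h : F.deg i b = j then C (c ⟨b, h⟩) else 0
  let ext' : ({b : F'.ι i // F'.deg i b = j} → k) → F'.Mod i := fun c b =>
    if h : F'.deg i b = j then C (c ⟨b, h⟩) else 0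
  have ext_homog : ∀ c, F.IsHomog i j (ext c) := by
    intro c b
    simp only [ext]
    split_ifs with h
    · rw [h, sub_self]
      exact C_mem_polyPiece _
    · exact Submodule.zero_mem _
  let T : ({b : F.ι i // F.deg i b = j} → k) →ₗ[k] ({b : F'.ι i // F'.deg i b = j} → k) :=
    { toFun := fun c b => constantCoeff (φ.map i (ext c) b)
      map_add' := by
        intro c c'
        have : ext (c + c') = ext c + ext c' := by
          funext b
          simp only [ext, Pi.add_apply]
          split_ifs <;> simp
        rw [this]
        funext b
        simp
      map_smul' := by
        intro r c
        have : ext (r • c) = (C r : Poly k n) • ext c := by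
          funext b
          simp only [ext, Pi.smul_apply]
          split_ifs <;> simp
        rw [this]
        funext b
        simp }
  have hT : ∀ c, φ.map i (ext c) - ext' (T c) ∈
      maxIdeal k n • (⊤ : Submodule (Poly k n) (F'.Mod i)) := by
    intro c
    rw [mem_maxIdeal_smul_top_iff]
    intro b
    simp only [Pi.sub_apply, map_sub, ext']
    split_ifs with h
    · simp [T]
    -- At a basis element of degree other than `j`, the coordinate is homogeneous of nonzero degree,
    -- hence has no constant term.
    · rw [map_zero, sub_zero]
      exact constantCoeff_of_mem_polyPiece_ne (φ.map_deg i j _ (ext_homog c) b) (by omega)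
  have hinj : Function.Injective T := by
    rw [← LinearMap.ker_eq_bot, LinearMap.ker_eq_bot']
    intro c hc
    have h1 := hT c
    rw [hc] at h1
    have h2 : ext' 0 = 0 := by
      funext b
      simp only [ext']
      split_ifs <;> simp
    rw [h2, sub_zero] at h1
    have h3 := map_mem_maxIdeal_smul_top (φ'.map i) h1
    have h4 := Submodule.sub_mem _ h3 (key (ext c))
    rw [LinearMap.sub_apply, LinearMap.comp_apply, LinearMap.id_apply, sub_sub_cancel,
      mem_maxIdeal_smul_top_iff] at h4
    funext b
    have := h4 b.1
    simpa [ext, b.2] using this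
  have hle := LinearMap.finrank_le_finrank_of_injective hinj
  have := Fintype.ofFinite {b : F.ι i // F.deg i b = j}
  have := Fintype.ofFinite {b : F'.ι i // F'.deg i b = j}
  rw [Module.finrank_fintype_fun_eq_card, Module.finrank_fintype_fun_eq_card] at hle
  unfold count
  rwa [Nat.card_eq_fintype_card, Nat.card_eq_fintype_card]

theorem IsMinRes.count_eq {F F' : GradedComplex k n} {ε : F.Mod 0 →ₗ[Poly k n] M}
    {ε' : F'.Mod 0 →ₗ[Poly k n] M} (hF : F.IsMinRes gr ε) (hF' : F'.IsMinRes gr ε')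
    {π : ℤ → M →+ M} (hπ : IsGradedProj gr π) (i : ℕ) (j : ℤ) :
    F.count i j = F'.count i j :=
  le_antisymm (hF.count_le hF' hπ i j) (hF'.count_le hF hπ i j)

/-- By `count_eq` the set whose infimum defines `gradedBetti` is a singleton, so any minimal
resolution computes it. -/
theorem IsMinRes.gradedBetti_eq {F : GradedComplex k n} {ε : F.Mod 0 →ₗ[Poly k n] M}
    (hF : F.IsMinRes gr ε) {π : ℤ → M →+ M} (hπ : IsGradedProj gr π) (i : ℕ) (j : ℤ) :
    gradedBetti (k := k) (n := n) gr i j = F.count i j := by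
  unfold gradedBetti
  rw [if_neg (by omega), Int.toNat_natCast]
  have : {c : ℕ | ∃ (F : GradedComplex k n) (ε : F.Mod 0 →ₗ[Poly k n] M),
      F.IsMinRes gr ε ∧ c = F.count i j} = {F.count i j} := by
    ext c
    simp only [Set.mem_ofPred_eq, Set.mem_singleton_iff]
    constructor
    · rintro ⟨F', ε', h, rfl⟩
      exact h.count_eq hF hπ i j
    · rintro rfl
      exact ⟨F, ε, hF, rfl⟩
  rw [this, csInf_singleton]

end GradedComplex

/-! ### The grading of R/A and multiplication by f. -/

/-- The projection of `(R/A)(-c)` onto its piece of degree `e`. -/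
def quotProj {A : Ideal (Poly k n)} (hA : IsHomogIdeal A) (c e : ℤ) :
    (Poly k n ⧸ A) →+ (Poly k n ⧸ A) :=
  QuotientAddGroup.map A.toAddSubgroup A.toAddSubgroup (polyComp k n (e - c)).toAddMonoidHom
    (fun p hp => hA p hp _)

theorem quotProj_mk {A : Ideal (Poly k n)} (hA : IsHomogIdeal A) (c e : ℤ) (p : Poly k n) :
    quotProj hA c e (Ideal.Quotient.mk A p) = Ideal.Quotient.mk A (polyComp k n (e - c) p) :=
  rfl

theorem isGradedProj_quotProj {A : Ideal (Poly k n)} (hA : IsHomogIdeal A) (c : ℤ) :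
    IsGradedProj (quotPiece A c) (quotProj hA c) where
  mem e x := by
    obtain ⟨p, rfl⟩ := Ideal.Quotient.mk_surjective x
    rw [quotProj_mk]
    exact ⟨_, polyComp_mem _ p, rfl⟩
  self e x := by
    rintro ⟨p, hp, rfl⟩
    change quotProj hA c e (Ideal.Quotient.mk A p) = Ideal.Quotient.mk A p
    rw [quotProj_mk, polyComp_of_mem hp]
  ne e e' x := by
    rintro ⟨p, hp, rfl⟩ h
    change quotProj hA c e' (Ideal.Quotient.mk A p) = 0
    rw [quotProj_mk, polyComp_of_mem_ne hp (by omega), map_zero]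

theorem mulMap_mk (A : Ideal (Poly k n)) (f p : Poly k n) :
    mulMap A f (Ideal.Quotient.mk _ p) = Ideal.Quotient.mk A (p * f) := rfl

theorem mulMap_injective (A : Ideal (Poly k n)) (f : Poly k n) :
    Function.Injective (mulMap A f) := by
  rw [injective_iff_map_eq_zero]
  intro x
  obtain ⟨p, rfl⟩ := Ideal.Quotient.mk_surjective x
  rw [mulMap_mk, Ideal.Quotient.eq_zero_iff_mem, Ideal.Quotient.eq_zero_iff_mem]
  exact fun h => Submodule.mem_colon_singleton.mpr h

theorem mulMap_mem_quotPiece (A : Ideal (Poly k n)) {f : Poly k n} {c : ℤ}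
    (hf : f ∈ polyPiece k n c) {e : ℤ} {x : Poly k n ⧸ (A.colon {f} : Ideal (Poly k n))}
    (hx : x ∈ quotPiece (A.colon {f}) c e) : mulMap A f x ∈ quotPiece A 0 e := by
  obtain ⟨p, hp, rfl⟩ := hx
  refine ⟨p * f, ?_, rfl⟩
  have := mul_mem_polyPiece hp hf
  rwa [sub_add_cancel, ← sub_zero e] at this

/-! ### Mapping cones, shifts and their basis counts. -/

namespace GradedComplex

theorem cone_d_zero {F G : GradedComplex k n} (ψ : Hom G F) (z : F.ι 1 ⊕ G.ι 0 → Poly k n) :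
    (cone ψ).d 0 z = ψ.map 0 (fun b => z (Sum.inr b)) + F.d 0 (fun b => z (Sum.inl b)) := rfl

theorem cone_d_succ {F G : GradedComplex k n} (ψ : Hom G F) (i : ℕ)
    (z : F.ι (i + 2) ⊕ G.ι (i + 1) → Poly k n) :
    (cone ψ).d (i + 1) z = Sum.elim
      (ψ.map (i + 1) (fun b => z (Sum.inr b)) + F.d (i + 1) (fun b => z (Sum.inl b)))
      (-(G.d i (fun b => z (Sum.inr b)))) := rfl

/-- The diagram chase for exactness: write z = (x, y) with y = dy'. Then 0 = ψy + dx = d(ψy' + x),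
so ψy' + x = dx', and (x', -y') is a preimage; the sign compensates the one in the differential of
the cone. -/
theorem mem_range_cone_d {F G : GradedComplex k n} (ψ : Hom G F) (i : ℕ)
    (hF : Function.Exact (F.d (i + 1)) (F.d i)) (z : F.ι (i + 1) ⊕ G.ι i → Poly k n)
    (hz : ψ.map i (fun b => z (Sum.inr b)) + F.d i (fun b => z (Sum.inl b)) = 0)
    (hG : (fun b => z (Sum.inr b)) ∈ Set.range (G.d i)) :
    z ∈ Set.range ((cone ψ).d (i + 1)) := by
  obtain ⟨y', hy'⟩ := hG
  rw [← hy', ← ψ.comm, ← map_add] at hz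
  obtain ⟨x', hx'⟩ := (hF _).mp hz
  refine ⟨Sum.elim x' (-y'), ?_⟩
  rw [cone_d_succ]
  funext b
  rcases b with b | b
  · change (ψ.map (i + 1) (-y') + F.d (i + 1) x') b = _
    rw [hx', map_neg, neg_add_cancel_left]
  · change (-(G.d i (-y'))) b = _
    rw [map_neg, neg_neg, hy']

/-- The mapping cone over the multiplication by `f` is a resolution of `R/(A + (f))`; it is
minimal if the map of complexes is zero modulo `𝔪`. -/
theorem isMinRes_cone {F G : GradedComplex k n} {A B : Ideal (Poly k n)} {f : Poly k n} {c : ℤ}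
    {ε : F.Mod 0 →ₗ[Poly k n] (Poly k n ⧸ A)} (hF : F.IsMinRes (quotPiece A 0) ε)
    {η : G.Mod 0 →ₗ[Poly k n] (Poly k n ⧸ (A.colon {f} : Ideal (Poly k n)))}
    (hG : G.IsMinRes (quotPiece (A.colon {f}) c) η) (ψ : Hom G F)
    (hψ : ∀ y : G.Mod 0, ε (ψ.map 0 y) = mulMap A f (η y)) (hAB : A ≤ B)
    (hB : B = A ⊔ Ideal.span {f})
    (hmin : ∀ i y, ψ.map i y ∈ maxIdeal k n • (⊤ : Submodule (Poly k n) (F.Mod i))) :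
    (cone ψ).IsMinRes (quotPiece B 0) (coneAug ψ hAB ε) where
  graded e x hx := by
    obtain ⟨p, hp, h⟩ := hF.graded e x hx
    refine ⟨p, hp, ?_⟩
    change _ = Submodule.mapQ A B LinearMap.id hAB (ε x)
    rw [← h]
    rfl
  surjective y := by
    obtain ⟨p, rfl⟩ := Ideal.Quotient.mk_surjective y
    obtain ⟨x, hx⟩ := hF.surjective (Ideal.Quotient.mk A p)
    refine ⟨x, ?_⟩
    change Submodule.mapQ A B LinearMap.id hAB (ε x) = _
    rw [hx]
    rfl
  exact_zero := by
    intro (x : F.Mod 0)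
    change Submodule.mapQ A B LinearMap.id hAB (ε x) = 0 ↔ _
    constructor
    · intro h
      obtain ⟨p, hp⟩ := Ideal.Quotient.mk_surjective (ε x)
      rw [← hp] at h
      have h1 : p ∈ B := Ideal.Quotient.eq_zero_iff_mem.mp h
      rw [hB, Submodule.mem_sup] at h1
      obtain ⟨q, hq, r, hr, rfl⟩ := h1
      obtain ⟨s, rfl⟩ := Ideal.mem_span_singleton'.mp hr
      -- The multiple `s * f` of `f` is absorbed by lifting the class of `s` to `G` and applying ψ.
      obtain ⟨y, hy⟩ := hG.surjective (Ideal.Quotient.mk _ s)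
      have h2 : ε (x - ψ.map 0 y) = 0 := by
        rw [map_sub, hψ, hy, mulMap_mk, ← hp, map_add, Ideal.Quotient.eq_zero_iff_mem.mpr hq,
          zero_add, sub_self]
      obtain ⟨x', hx'⟩ := (hF.exact_zero _).mp h2
      refine ⟨Sum.elim x' y, ?_⟩
      rw [cone_d_zero]
      change ψ.map 0 y + F.d 0 x' = x
      rw [hx', add_sub_cancel]
    · rintro ⟨z, rfl⟩
      have h1 : ε (ψ.map 0 (fun b => z (Sum.inr b)) + F.d 0 (fun b => z (Sum.inl b))) =
          mulMap A f (η fun b => z (Sum.inr b)) := by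
        rw [map_add, hψ, hF.exact_zero.apply_apply_eq_zero, add_zero]
      obtain ⟨s, hs⟩ := Ideal.Quotient.mk_surjective (η fun b => z (Sum.inr b))
      rw [← hs, mulMap_mk] at h1
      refine (congrArg (Submodule.mapQ A B LinearMap.id hAB) h1).trans ?_
      refine Ideal.Quotient.eq_zero_iff_mem.mpr ?_
      rw [hB]
      exact Ideal.mem_sup_right (Ideal.mem_span_singleton'.mpr ⟨s, rfl⟩)
  exact_succ i z := by
    refine ⟨fun hz => ?_, fun ⟨x, hx⟩ => hx ▸ (cone ψ).d_comp_d i x⟩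
    cases i with
    | zero =>
      have hz' : ψ.map 0 (fun b => z (Sum.inr b)) + F.d 0 (fun b => z (Sum.inl b)) = 0 := hz
      refine mem_range_cone_d ψ 0 (hF.exact_succ 0) z hz' ?_
      -- The lowest degree uses injectivity of R/(A : f) → R/A: f·η(y) = ε(ψy) = -ε(dx) = 0 gives
      -- η(y) = 0.
      refine (hG.exact_zero _).mp (mulMap_injective A f ?_)
      rw [← hψ, eq_neg_of_add_eq_zero_left hz', map_neg, hF.exact_zero.apply_apply_eq_zero,
        neg_zero, map_zero]
    | succ i =>
      refine mem_range_cone_d ψ (i + 1) (hF.exact_succ (i + 1)) z ?_ ?_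
      · funext b
        exact congrFun hz (Sum.inl b)
      · refine (hG.exact_succ i _).mp (neg_eq_zero.mp ?_)
        funext b
        exact congrFun hz (Sum.inr b)
  minimal i := by
    have := F.fin
    have := G.fin
    have := (cone ψ).fin
    rintro _ ⟨z, rfl⟩
    have h1 : ∀ (y : G.Mod i) (x : F.Mod (i + 1)) b,
        constantCoeff ((ψ.map i y + F.d i x) b) = 0 := fun y x =>
      mem_maxIdeal_smul_top_iff.mp (Submodule.add_mem _ (hmin i y) (hF.minimal i ⟨x, rfl⟩))
    rw [mem_maxIdeal_smul_top_iff]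
    cases i with
    | zero => exact h1 _ _
    | succ i =>
      rintro (b | b)
      · exact h1 _ _ b
      · exact mem_maxIdeal_smul_top_iff.mp
          (Submodule.neg_mem _ (hG.minimal i ⟨fun b => z (Sum.inr b), rfl⟩)) b

/-- The shifted complex `F(c)`. -/
def shift (F : GradedComplex k n) (c : ℤ) : GradedComplex k n where
  ι := F.ι
  fin := F.fin
  deg i b := F.deg i b - c
  d := F.d
  d_deg i e x hx b := by
    have := F.d_deg i (e + c) x (fun b => by
      rw [show e + c - F.deg (i + 1) b = e - (F.deg (i + 1) b - c) by ring]
      exact hx b) b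
    rwa [show e + c - F.deg i b = e - (F.deg i b - c) by ring] at this
  d_comp_d := F.d_comp_d

theorem IsMinRes.shift {F : GradedComplex k n} {A : Ideal (Poly k n)} {c : ℤ}
    {ε : F.Mod 0 →ₗ[Poly k n] (Poly k n ⧸ A)} (hF : F.IsMinRes (quotPiece A c) ε) :
    (F.shift c).IsMinRes (quotPiece A 0) ε where
  graded e x hx := by
    have h := hF.graded (e + c) x (fun b => by
      rw [show e + c - F.deg 0 b = e - (F.deg 0 b - c) by ring]
      exact hx b)
    unfold quotPiece at h ⊢
    rwa [show e + c - c = e - 0 by ring] at h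
  surjective := hF.surjective
  exact_zero := hF.exact_zero
  exact_succ := hF.exact_succ
  minimal := hF.minimal

theorem count_shift (F : GradedComplex k n) (c : ℤ) (i : ℕ) (j : ℤ) :
    (F.shift c).count i (j - c) = F.count i j := by
  refine Nat.card_congr (Equiv.subtypeEquivRight fun b => ?_)
  change F.deg i b - c = j - c ↔ F.deg i b = j
  omega

/-- `quotBetti` refers to the unshifted grading of R/A, so a resolution of (R/A)(-c) is shifted back
by `c` first. -/
theorem IsMinRes.quotBetti_eq {F : GradedComplex k n} {A : Ideal (Poly k n)} {c : ℤ}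
    (hA : IsHomogIdeal A) {ε : F.Mod 0 →ₗ[Poly k n] (Poly k n ⧸ A)}
    (hF : F.IsMinRes (quotPiece A c) ε) (i : ℕ) (j : ℤ) :
    quotBetti A i (j - c) = F.count i j := by
  rw [← count_shift]
  exact hF.shift.gradedBetti_eq (isGradedProj_quotProj hA 0) i (j - c)

theorem count_cone_succ {F G : GradedComplex k n} (ψ : Hom G F) (i : ℕ) (j : ℤ) :
    (cone ψ).count (i + 1) j = F.count (i + 1) j + G.count i j := by
  have := F.fin (i + 1)
  have := G.fin i
  unfold count
  rw [← Nat.card_sum]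
  exact Nat.card_congr (Equiv.subtypeSum)

end GradedComplex

theorem quotBetti_of_neg (A : Ideal (Poly k n)) {i : ℤ} (hi : i < 0) (j : ℤ) :
    quotBetti A i j = 0 := if_pos hi

/-! ### Monomial ideals and their colons. -/

theorem span_range_monomial_image {S : Set (Poly k n)} (hS : ∀ u ∈ S, IsMonomial u) :
    (fun s => monomial s (1 : k)) '' {s | monomial s (1 : k) ∈ S} = S := by
  ext u
  constructor
  · rintro ⟨s, hs, rfl⟩
    exact hs
  · intro hu
    obtain ⟨s, rfl⟩ := hS u hu
    exact ⟨s, hu, rfl⟩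

theorem mem_span_monomials_iff {S : Set (Poly k n)} (hS : ∀ u ∈ S, IsMonomial u)
    {p : Poly k n} :
    p ∈ Ideal.span S ↔ ∀ s ∈ p.support, ∃ t, monomial t (1 : k) ∈ S ∧ t ≤ s := by
  conv_lhs => rw [← span_range_monomial_image hS]
  exact mem_ideal_span_monomial_image

theorem monomial_mem_span_monomials_iff {S : Set (Poly k n)} (hS : ∀ u ∈ S, IsMonomial u)
    {s : Fin n →₀ ℕ} :
    monomial s (1 : k) ∈ Ideal.span S ↔ ∃ t, monomial t (1 : k) ∈ S ∧ t ≤ s := by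
  classical
  rw [mem_span_monomials_iff hS, support_monomial, if_neg one_ne_zero]
  simp

theorem monomial_mem_of_le {I : Ideal (Poly k n)} {s t : Fin n →₀ ℕ} (h : s ≤ t)
    (hs : monomial s (1 : k) ∈ I) : monomial t (1 : k) ∈ I := by
  obtain ⟨c, rfl⟩ := exists_add_of_le h
  have := I.mul_mem_right (monomial c (1 : k)) hs
  rwa [monomial_mul, one_mul] at this

theorem IsMonomialIdeal.mem_iff {I : Ideal (Poly k n)} (hI : IsMonomialIdeal I) {p : Poly k n} :
    p ∈ I ↔ ∀ s ∈ p.support, monomial s (1 : k) ∈ I := by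
  obtain ⟨S, hS, rfl⟩ := hI
  rw [mem_span_monomials_iff hS]
  exact forall₂_congr fun s _ => (monomial_mem_span_monomials_iff hS).symm

theorem isMonomialIdeal_of_forall {I : Ideal (Poly k n)}
    (h : ∀ p ∈ I, ∀ s ∈ p.support, monomial s (1 : k) ∈ I) : IsMonomialIdeal I := by
  refine ⟨{u | IsMonomial u ∧ u ∈ I}, fun u hu => hu.1, le_antisymm (fun p hp => ?_) ?_⟩
  · rw [mem_span_monomials_iff fun u hu => hu.1]
    exact fun s hs => ⟨s, ⟨⟨s, rfl⟩, h p hp s hs⟩, le_rfl⟩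
  · rw [Ideal.span_le]
    exact fun u hu => hu.2

theorem IsMonomialIdeal.le_of_forall {I I' : Ideal (Poly k n)} (hI : IsMonomialIdeal I)
    (hI' : IsMonomialIdeal I')
    (h : ∀ s : Fin n →₀ ℕ, monomial s (1 : k) ∈ I → monomial s (1 : k) ∈ I') : I ≤ I' :=
  fun _ hp => hI'.mem_iff.mpr fun s hs => h s (hI.mem_iff.mp hp s hs)

theorem IsMonomialIdeal.isHomogIdeal {I : Ideal (Poly k n)} (hI : IsMonomialIdeal I) :
    IsHomogIdeal I := by
  intro p hp e
  rw [hI.mem_iff]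
  intro s hs
  refine hI.mem_iff.mp hp s ?_
  rw [mem_support_iff, coeff_polyComp] at hs
  rw [mem_support_iff]
  intro h
  simp [h] at hs

theorem isMonomialIdeal_span {S : Set (Poly k n)} (hS : ∀ u ∈ S, IsMonomial u) :
    IsMonomialIdeal (Ideal.span S) := ⟨S, hS, rfl⟩

theorem IsMonomialIdeal.sup {I I' : Ideal (Poly k n)} (hI : IsMonomialIdeal I)
    (hI' : IsMonomialIdeal I') : IsMonomialIdeal (I ⊔ I') := by
  obtain ⟨S, hS, rfl⟩ := hI
  obtain ⟨S', hS', rfl⟩ := hI'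
  exact ⟨S ∪ S', fun u hu => hu.elim (hS u) (hS' u), (Ideal.span_union S S').symm⟩

/-- A monomial in an ideal generated by monomials is divisible by a single generator, which comes
from one of the two ideals. -/
theorem IsMonomialIdeal.monomial_mem_sup_iff {I I' : Ideal (Poly k n)} (hI : IsMonomialIdeal I)
    (hI' : IsMonomialIdeal I') {s : Fin n →₀ ℕ} :
    monomial s (1 : k) ∈ I ⊔ I' ↔ monomial s (1 : k) ∈ I ∨ monomial s (1 : k) ∈ I' := by
  refine ⟨fun h => ?_, fun h => h.elim (fun h => Ideal.mem_sup_left h)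
    fun h => Ideal.mem_sup_right h⟩
  obtain ⟨S, hS, rfl⟩ := hI
  obtain ⟨S', hS', rfl⟩ := hI'
  rw [← Ideal.span_union, monomial_mem_span_monomials_iff
    fun u hu => hu.elim (hS u) (hS' u)] at h
  rw [monomial_mem_span_monomials_iff hS, monomial_mem_span_monomials_iff hS']
  obtain ⟨t, ht | ht, hts⟩ := h
  · exact Or.inl ⟨t, ht, hts⟩
  · exact Or.inr ⟨t, ht, hts⟩

theorem monomial_mem_colon_iff {I : Ideal (Poly k n)} {s c : Fin n →₀ ℕ} :
    monomial s (1 : k) ∈ (I.colon {monomial c (1 : k)} : Ideal (Poly k n)) ↔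
      monomial (s + c) (1 : k) ∈ I := by
  rw [Submodule.mem_colon_singleton, smul_eq_mul, monomial_mul, one_mul]

theorem IsMonomialIdeal.colon {I : Ideal (Poly k n)} (hI : IsMonomialIdeal I)
    (c : Fin n →₀ ℕ) : IsMonomialIdeal (I.colon {monomial c (1 : k)} : Ideal (Poly k n)) := by
  refine isMonomialIdeal_of_forall fun p hp s hs => ?_
  rw [monomial_mem_colon_iff]
  rw [Submodule.mem_colon_singleton, smul_eq_mul] at hp
  refine hI.mem_iff.mp hp _ ?_
  rw [mem_support_iff, coeff_mul_monomial, mul_one]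
  exact mem_support_iff.mp hs

theorem colon_colon (I : Ideal (Poly k n)) (f g : Poly k n) :
    ((I.colon {f} : Ideal (Poly k n)).colon {g} : Ideal (Poly k n)) = I.colon {f * g} := by
  ext p
  simp only [Submodule.mem_colon_singleton, smul_eq_mul]
  rw [mul_right_comm, mul_assoc]

/-- If `P : x^c = P` then `(J + P) : x^c = (J : x^c) + P`. -/
theorem IsMonomialIdeal.sup_colon {J P : Ideal (Poly k n)} (hJ : IsMonomialIdeal J)
    (hP : IsMonomialIdeal P) {c : Fin n →₀ ℕ}
    (hc : (P.colon {monomial c (1 : k)} : Ideal (Poly k n)) ≤ P) :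
    ((J ⊔ P).colon {monomial c (1 : k)} : Ideal (Poly k n)) =
      J.colon {monomial c (1 : k)} ⊔ P := by
  apply le_antisymm
  · refine ((hJ.sup hP).colon c).le_of_forall ((hJ.colon c).sup hP) fun s hs => ?_
    rw [monomial_mem_colon_iff, hJ.monomial_mem_sup_iff hP] at hs
    rw [(hJ.colon c).monomial_mem_sup_iff hP, monomial_mem_colon_iff]
    exact hs.imp_right fun h => hc (monomial_mem_colon_iff.mpr h)
  · refine ((hJ.colon c).sup hP).le_of_forall ((hJ.sup hP).colon c) fun s hs => ?_
    rw [(hJ.colon c).monomial_mem_sup_iff hP, monomial_mem_colon_iff] at hs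
    rw [monomial_mem_colon_iff, hJ.monomial_mem_sup_iff hP]
    exact hs.imp_right fun h => monomial_mem_of_le le_self_add h

theorem X_pow_eq_monomial' (x : Fin n) (a : ℕ) :
    (X x : Poly k n) ^ a = monomial (Finsupp.single x a) 1 := X_pow_eq_monomial

theorem isMonomial_X_pow (x : Fin n) (a : ℕ) : IsMonomial ((X x : Poly k n) ^ a) :=
  ⟨_, X_pow_eq_monomial' x a⟩

theorem X_pow_mem_polyPiece (x : Fin n) (a : ℕ) : (X x : Poly k n) ^ a ∈ polyPiece k n a := by
  rw [X_pow_eq_monomial']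
  simpa using monomial_mem_polyPiece (k := k) (Finsupp.single x a) 1

/-! ### The colon condition that governs minimality. -/

/-- Either `x^a ∈ J` or `J : x^a = J : x^{a-1}`. For a monomial ideal this says that no
minimal generator other than `x^a` is divisible by `x^a`. -/
def ColonStable (J : Ideal (Poly k n)) (x : Fin n) (a : ℕ) : Prop :=
  (X x : Poly k n) ^ a ∈ J ∨
    (J.colon {(X x : Poly k n) ^ a} : Ideal (Poly k n)) ≤ J.colon {(X x : Poly k n) ^ (a - 1)}

/-- Colons commute: (J : f) : x^a = (J : x^a) : f, and likewise for x^(a-1). -/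
theorem ColonStable.colon {J : Ideal (Poly k n)} {x : Fin n} {a : ℕ} (h : ColonStable J x a)
    (f : Poly k n) : ColonStable (J.colon {f}) x a := by
  refine h.imp (fun h => ?_) (fun h => ?_)
  · exact Submodule.mem_colon_singleton.mpr (J.mul_mem_right f h)
  · intro p hp
    rw [colon_colon, mul_comm, ← colon_colon] at hp ⊢
    exact Submodule.mem_colon_singleton.mpr (h (Submodule.mem_colon_singleton.mp hp))

/-- The chain is (J + P) : x^a = (J : x^a) + P ≤ (J : x^(a-1)) + P ≤ (J + P) : x^(a-1). -/
theorem ColonStable.sup {J P : Ideal (Poly k n)} (hJ : IsMonomialIdeal J)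
    (hP : IsMonomialIdeal P) {x : Fin n} {a : ℕ} (h : ColonStable J x a)
    (hc : (P.colon {(X x : Poly k n) ^ a} : Ideal (Poly k n)) ≤ P) :
    ColonStable (J ⊔ P) x a := by
  refine h.imp (fun h => Ideal.mem_sup_left h) (fun h => ?_)
  rw [X_pow_eq_monomial'] at hc
  rw [X_pow_eq_monomial', X_pow_eq_monomial'] at h ⊢
  rw [hJ.sup_colon hP hc, sup_le_iff]
  refine ⟨h.trans fun p hp => ?_, fun p hp => ?_⟩
  · exact Submodule.mem_colon_singleton.mpr
      (Ideal.mem_sup_left (Submodule.mem_colon_singleton.mp hp))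
  · exact Submodule.mem_colon_singleton.mpr
      (Ideal.mul_mem_right _ _ (Ideal.mem_sup_right hp))

theorem exists_minGens_dvd {J : Ideal (Poly k n)} {s : Fin n →₀ ℕ}
    (hs : monomial s (1 : k) ∈ J) :
    ∃ t ≤ s, monomial t (1 : k) ∈ minGens J := by
  obtain ⟨t, ⟨hts, ht⟩, hmin⟩ := WellFounded.has_min (wellFounded_lt (α := Fin n →₀ ℕ))
    {t | t ≤ s ∧ monomial t (1 : k) ∈ J} ⟨s, le_rfl, hs⟩
  refine ⟨t, hts, ⟨t, rfl⟩, ht, ?_⟩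
  rintro _ ⟨c, rfl⟩ hc hdvd
  rw [monomial_dvd_monomial] at hdvd
  have hct : c ≤ t := hdvd.1.resolve_left one_ne_zero
  obtain h | h := hct.eq_or_lt
  · rw [h]
  · exact absurd h (hmin c ⟨hct.trans hts, hc⟩)

/-- A generator of J divisible by x^a would, by minimality in I, be x^a itself. If x^a ∉ J, every
generator thus has x-exponent at most a - 1, so one that divides x^s·x^a already divides
x^s·x^(a-1). This is where the hypothesis on minimal generators enters. -/
theorem colonStable_of_minGens_subset {J I : Ideal (Poly k n)} (hJ : IsMonomialIdeal J)
    (hG : minGens J ⊆ minGens I) {x : Fin n} {a : ℕ} (hx : (X x : Poly k n) ^ a ∈ I) :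
    ColonStable J x a := by
  rw [ColonStable, or_iff_not_imp_left]
  rw [X_pow_eq_monomial'] at hx
  rw [X_pow_eq_monomial', X_pow_eq_monomial']
  intro hxJ
  refine (hJ.colon _).le_of_forall (hJ.colon _) fun s hs => ?_
  rw [monomial_mem_colon_iff] at hs ⊢
  obtain ⟨t, hts, ht⟩ := exists_minGens_dvd hs
  have htx : t x < a := by
    by_contra h
    have hle : Finsupp.single x a ≤ t := Finsupp.single_le_iff.mpr (not_lt.mp h)
    have := (hG ht).2.2 _ ⟨_, rfl⟩ hx (monomial_dvd_monomial.mpr ⟨Or.inr hle, one_dvd _⟩)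
    exact hxJ (this ▸ ht.2.1)
  refine monomial_mem_of_le (fun y => ?_) ht.2.1
  have := hts y
  by_cases hy : y = x
  · subst hy
    simp only [Finsupp.add_apply, Finsupp.single_eq_same] at this ⊢
    omega
  · simpa [Finsupp.single_eq_of_ne hy] using this

/-- A power of another variable that divides x^s·x_t^a divides x^s, since x_t^a does not involve
that variable. -/
theorem span_X_pow_colon_le {T : Type*} {v : T → Fin n} (hv : Function.Injective v) (a : T → ℕ)
    (S : Set T) {t : T} (ht : t ∉ S) :
    ((Ideal.span ((fun t => (X (v t) : Poly k n) ^ a t) '' S)).colon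
      {(X (v t) : Poly k n) ^ a t} : Ideal (Poly k n)) ≤
        Ideal.span ((fun t => (X (v t) : Poly k n) ^ a t) '' S) := by
  have hS : ∀ u ∈ (fun t => (X (v t) : Poly k n) ^ a t) '' S, IsMonomial u := by
    rintro _ ⟨s, -, rfl⟩
    exact isMonomial_X_pow _ _
  have hP := isMonomialIdeal_span hS
  rw [X_pow_eq_monomial' (v t) (a t)]
  refine (hP.colon _).le_of_forall hP fun s hs => ?_
  rw [monomial_mem_colon_iff, monomial_mem_span_monomials_iff hS] at hs
  obtain ⟨c, ⟨r, hr, hrc⟩, hcs⟩ := hs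
  dsimp only at hrc
  rw [X_pow_eq_monomial', (monomial_left_injective one_ne_zero).eq_iff] at hrc
  subst hrc
  rw [monomial_mem_span_monomials_iff hS]
  refine ⟨_, ⟨r, hr, X_pow_eq_monomial' _ _⟩, Finsupp.single_le_iff.mpr ?_⟩
  have h := Finsupp.single_le_iff.mp hcs
  have hne : v r ≠ v t := fun h => ht (hv h ▸ hr)
  simpa [Finsupp.single_eq_of_ne hne] using h

theorem isMonomialIdeal_span_X_pow {T : Type*} (v : T → Fin n) (a : T → ℕ) (S : Set T) :
    IsMonomialIdeal (Ideal.span ((fun t => (X (v t) : Poly k n) ^ a t) '' S)) := by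
  refine isMonomialIdeal_span ?_
  rintro _ ⟨s, -, rfl⟩
  exact isMonomial_X_pow _ _

/-! ### One cone step and the recursion for Betti numbers. -/

/-- A chain map lifting the multiplication by `x^a` has image in `𝔪 F`, because it lifts
a multiple of `x`. -/
theorem ColonStable.lift_mem {A : Ideal (Poly k n)} {x : Fin n} {a : ℕ}
    (h : ColonStable A x a) (ha : 0 < a) {F G : GradedComplex k n}
    {ε : F.Mod 0 →ₗ[Poly k n] (Poly k n ⧸ A)} (hF : F.IsMinRes (quotPiece A 0) ε) {c : ℤ}
    {η : G.Mod 0 →ₗ[Poly k n] (Poly k n ⧸ (A.colon {(X x : Poly k n) ^ a} : Ideal (Poly k n)))}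
    (hG : G.IsMinRes (quotPiece (A.colon {(X x : Poly k n) ^ a}) c) η)
    (ψ : GradedComplex.Hom G F) (hψ : ∀ y : G.Mod 0, ε (ψ.map 0 y) = mulMap A (X x ^ a) (η y))
    (i : ℕ) (y : G.Mod i) :
    ψ.map i y ∈ maxIdeal k n • (⊤ : Submodule (Poly k n) (F.Mod i)) := by
  have hη : ∀ y, η (G.d 0 y) = 0 := hG.exact_zero.apply_apply_eq_zero
  obtain h | h := h
  · refine hF.lift_smul_mem hη hG.minimal ψ 0 (Ideal.zero_mem (maxIdeal k n)) (fun y => ?_) i y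
    rw [hψ, zero_smul]
    obtain ⟨p, hp⟩ := Ideal.Quotient.mk_surjective (η y)
    rw [← hp, mulMap_mk, Ideal.Quotient.eq_zero_iff_mem]
    exact A.mul_mem_left p h
  -- Multiplication by x^(a-1) is well defined on R/(A : x^a) because A : x^a ≤ A : x^(a-1); x times
  -- it is multiplication by x^a, as a > 0.
  · refine hF.lift_smul_mem hη hG.minimal ψ
      ((mulMap A (X x ^ (a - 1))).comp (Submodule.mapQ _ _ LinearMap.id h))
      (Ideal.subset_span ⟨x, rfl⟩ : X x ∈ maxIdeal k n) (fun y => ?_) i y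
    rw [hψ]
    obtain ⟨p, hp⟩ := Ideal.Quotient.mk_surjective (η y)
    rw [← hp, mulMap_mk]
    change _ = Ideal.Quotient.mk A (X x * (p * X x ^ (a - 1)))
    rw [mul_left_comm, mul_pow_sub_one ha.ne']

theorem exists_hom_lifting_mulMap {A : Ideal (Poly k n)} (hA : IsHomogIdeal A)
    {F G : GradedComplex k n} {ε : F.Mod 0 →ₗ[Poly k n] (Poly k n ⧸ A)}
    (hF : F.IsMinRes (quotPiece A 0) ε) {f : Poly k n} {c : ℤ} (hf : f ∈ polyPiece k n c)
    {η : G.Mod 0 →ₗ[Poly k n] (Poly k n ⧸ (A.colon {f} : Ideal (Poly k n)))}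
    (hG : G.IsMinRes (quotPiece (A.colon {f}) c) η) :
    ∃ ψ : GradedComplex.Hom G F, ∀ y : G.Mod 0, ε (ψ.map 0 y) = mulMap A f (η y) :=
  hF.exists_hom (isGradedProj_quotProj hA 0) (z := (mulMap A f).comp η)
    (fun y => by
      rw [LinearMap.comp_apply, hG.exact_zero.apply_apply_eq_zero, map_zero])
    (fun e y hy => mulMap_mem_quotPiece A hf (hG.graded e y hy))

theorem IsMonomialIdeal.isHomogIdeal_colon_X_pow {A : Ideal (Poly k n)} (hA : IsMonomialIdeal A)
    (x : Fin n) (a : ℕ) :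
    IsHomogIdeal (A.colon {(X x : Poly k n) ^ a} : Ideal (Poly k n)) := by
  rw [X_pow_eq_monomial']
  exact (hA.colon _).isHomogIdeal

/-- All three Betti numbers are read off from F, G and the cone of G → F, which is minimal by
`ColonStable.lift_mem`. -/
theorem quotBetti_sup_X_pow {A : Ideal (Poly k n)} (hA : IsMonomialIdeal A) {x : Fin n} {a : ℕ}
    (h : ColonStable A x a) (ha : 0 < a) (i j : ℤ) :
    quotBetti (A ⊔ Ideal.span {(X x : Poly k n) ^ a}) i j =
      quotBetti A i j + quotBetti (A.colon {(X x : Poly k n) ^ a}) (i - 1) (j - a) := by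
  obtain ⟨F, ε, hF⟩ := exists_isMinRes hA.isHomogIdeal 0
  have hA' := hA.isHomogIdeal_colon_X_pow x a
  obtain ⟨G, η, hG⟩ := exists_isMinRes hA' (a : ℤ)
  obtain ⟨ψ, hψ⟩ := exists_hom_lifting_mulMap hA.isHomogIdeal hF (X_pow_mem_polyPiece x a) hG
  have hC := GradedComplex.isMinRes_cone hF hG ψ hψ le_sup_left rfl (h.lift_mem ha hF hG ψ hψ)
  have hB : IsHomogIdeal (A ⊔ Ideal.span {(X x : Poly k n) ^ a}) := by
    refine (hA.sup (isMonomialIdeal_span ?_)).isHomogIdeal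
    rintro _ rfl
    exact isMonomial_X_pow x a
  have hFb := hF.quotBetti_eq hA.isHomogIdeal
  have hGb := hG.quotBetti_eq hA'
  have hCb := hC.quotBetti_eq hB
  simp only [sub_zero] at hFb hCb
  obtain hi | hi := lt_or_ge i 0
  · rw [quotBetti_of_neg _ hi, quotBetti_of_neg _ hi, quotBetti_of_neg _ (by omega)]
  obtain ⟨i, rfl⟩ := Int.eq_ofNat_of_zero_le hi
  obtain _ | i := i
  -- The cone has no contribution of G in degree 0, in accordance with the vanishing of β in degree
  -- -1.
  · rw [quotBetti_of_neg _ (show ((0 : ℕ) : ℤ) - 1 < 0 by omega), hCb, hFb, add_zero]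
    rfl
  · rw [show ((i + 1 : ℕ) : ℤ) - 1 = i by push_cast; ring, hCb, hFb, hGb,
      GradedComplex.count_cone_succ]

/-- The induction runs over all J at once, because removing the power x_t^a leads both to J and to J
: x_t^a. These account for the subsets without and with t. -/
theorem quotBetti_sup_span_X_pow {T : Type*} [DecidableEq T] {v : T → Fin n}
    (hv : Function.Injective v) {a : T → ℕ} (ha : ∀ t, 0 < a t) (S : Finset T)
    {J : Ideal (Poly k n)} (hJ : IsMonomialIdeal J)
    (h : ∀ t ∈ S, ColonStable J (v t) (a t)) (i j : ℤ) :
    quotBetti (J ⊔ Ideal.span ((fun t => (X (v t) : Poly k n) ^ a t) '' S)) i j =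
      ∑ σ ∈ S.powerset, quotBetti (J.colon {∏ t ∈ σ, (X (v t) : Poly k n) ^ a t})
        (i - σ.card) (j - ∑ t ∈ σ, (a t : ℤ)) := by
  induction S using Finset.induction_on generalizing J i j with
  | empty =>
    have h1 : (J.colon {(1 : Poly k n)} : Ideal (Poly k n)) = J := by
      ext p
      rw [Submodule.mem_colon_singleton, smul_eq_mul, mul_one]
    simp [h1]
  | insert t S ht ih =>
    have hP := isMonomialIdeal_span_X_pow (k := k) v a (S : Set T)
    have hc := span_X_pow_colon_le (k := k) hv a (S : Set T) (t := t) (by simpa using ht)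
    have hst := h t (Finset.mem_insert_self t S)
    have hJt : IsMonomialIdeal (J.colon {(X (v t) : Poly k n) ^ a t} : Ideal (Poly k n)) := by
      rw [X_pow_eq_monomial']
      exact hJ.colon _
    have hsc : ((J ⊔ Ideal.span ((fun t => (X (v t) : Poly k n) ^ a t) '' S)).colon
        {(X (v t) : Poly k n) ^ a t} : Ideal (Poly k n)) =
        J.colon {(X (v t) : Poly k n) ^ a t} ⊔
          Ideal.span ((fun t => (X (v t) : Poly k n) ^ a t) '' S) := by
      rw [X_pow_eq_monomial' (v t) (a t)] at hc ⊢
      exact hJ.sup_colon hP hc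
    rw [Finset.coe_insert, Set.image_insert_eq, Ideal.span_insert,
      sup_comm (Ideal.span {(X (v t) : Poly k n) ^ a t}), ← sup_assoc,
      quotBetti_sup_X_pow (hJ.sup hP) (hst.sup hJ hP hc) (ha t), hsc,
      ih hJ (fun s hs => h s (Finset.mem_insert_of_mem hs)),
      ih hJt (fun s hs => (h s (Finset.mem_insert_of_mem hs)).colon _),
      Finset.sum_powerset_insert ht]
    congr 1
    refine Finset.sum_congr rfl fun σ hσ => ?_
    have htσ : t ∉ σ := fun h => ht (Finset.mem_powerset.mp hσ h)
    rw [colon_colon, Finset.prod_insert htσ, Finset.sum_insert htσ,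
      Finset.card_insert_of_notMem htσ]
    congr 1
    · push_cast
      ring
    · ring

/-! ### Iterated mapping cones. -/

section IteratedCone

variable {m : ℕ} {J : Ideal (Poly k n)} {v : Fin m → Fin n} {a : Fin m → ℕ}
  {F₀ : GradedComplex k n} {ε₀ : F₀.Mod 0 →ₗ[Poly k n] (Poly k n ⧸ J)}

theorem sup_span_image_lt_succ (f : Fin m → Poly k n) (t : Fin m) :
    J ⊔ Ideal.span (f '' {s | (s : ℕ) < t + 1}) =
      J ⊔ Ideal.span (f '' {s | (s : ℕ) < t}) ⊔ Ideal.span {f t} := by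
  have : {s : Fin m | (s : ℕ) < t + 1} = insert t {s : Fin m | (s : ℕ) < t} := by
    ext s
    rw [Set.mem_insert_iff, Fin.ext_iff]
    change (s : ℕ) < t + 1 ↔ (s : ℕ) = t ∨ (s : ℕ) < t
    omega
  rw [this, Set.image_insert_eq, Ideal.span_insert, sup_comm (Ideal.span {f t}), sup_assoc]

theorem colonStable_sup_span_lt (hJ : IsMonomialIdeal J) (hv : Function.Injective v)
    {t : Fin m} (h : ColonStable J (v t) (a t)) :
    ColonStable (J ⊔ Ideal.span ((fun t => (X (v t) : Poly k n) ^ a t) ''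
      {s : Fin m | (s : ℕ) < t})) (v t) (a t) :=
  h.sup hJ (isMonomialIdeal_span_X_pow v a _)
    (span_X_pow_colon_le hv a _ (fun h' => lt_irrefl (t : ℕ) h'))

/-- The ideal reached is determined by the number of steps; identifying it in the same induction
gives access to `ColonStable` at the next step, whatever G and ψ were chosen. -/
theorem IteratedCone.isMinRes (hJ : IsMonomialIdeal J) (hv : Function.Injective v)
    (ha : ∀ t, 0 < a t) (h : ∀ t, ColonStable J (v t) (a t))
    (hF₀ : F₀.IsMinRes (quotPiece J 0) ε₀) {t : ℕ} {A : Ideal (Poly k n)}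
    {F : GradedComplex k n} {ε : F.Mod 0 →ₗ[Poly k n] (Poly k n ⧸ A)}
    (hc : IteratedCone (fun t => X (v t) ^ a t) a J F₀ ε₀ t A F ε) :
    A = J ⊔ Ideal.span ((fun t => (X (v t) : Poly k n) ^ a t) '' {s : Fin m | (s : ℕ) < t}) ∧
      F.IsMinRes (quotPiece A 0) ε := by
  induction hc with
  | start => exact ⟨by simp, hF₀⟩
  | step t A F ε _ G η hG ψ hψ B hB ih =>
    obtain ⟨rfl, hF⟩ := ih
    refine ⟨?_, ?_⟩
    · rw [sup_span_image_lt_succ, hB]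
    · exact GradedComplex.isMinRes_cone hF hG ψ hψ _ hB
        ((colonStable_sup_span_lt hJ hv (h t)).lift_mem (ha t) hF hG ψ hψ)

/-- The next ψ exists because the complex built so far is a resolution, by `IteratedCone.isMinRes`.
-/
theorem exists_iteratedCone (hJ : IsMonomialIdeal J) (hv : Function.Injective v)
    (ha : ∀ t, 0 < a t) (h : ∀ t, ColonStable J (v t) (a t))
    (hF₀ : F₀.IsMinRes (quotPiece J 0) ε₀) (t : ℕ) (ht : t ≤ m) :
    ∃ (F : GradedComplex k n) (ε : F.Mod 0 →ₗ[Poly k n] (Poly k n ⧸ _)),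
      IteratedCone (fun t => X (v t) ^ a t) a J F₀ ε₀ t
        (J ⊔ Ideal.span ((fun t => (X (v t) : Poly k n) ^ a t) ''
          {s : Fin m | (s : ℕ) < t})) F ε := by
  induction t with
  | zero =>
    have : J ⊔ Ideal.span ((fun t => (X (v t) : Poly k n) ^ a t) ''
        {s : Fin m | (s : ℕ) < 0}) = J := by simp
    rw [this]
    exact ⟨F₀, ε₀, .start⟩
  | succ t ih =>
    obtain ⟨F, ε, hc⟩ := ih (by omega)
    have hF := (hc.isMinRes hJ hv ha h hF₀).2
    have hA := hJ.sup
      (isMonomialIdeal_span_X_pow (k := k) v a {s : Fin m | (s : ℕ) < t})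
    let r : Fin m := ⟨t, ht⟩
    obtain ⟨G, η, hG⟩ := exists_isMinRes (hA.isHomogIdeal_colon_X_pow (v r) (a r)) (a r : ℤ)
    obtain ⟨ψ, hψ⟩ := exists_hom_lifting_mulMap hA.isHomogIdeal hF
      (X_pow_mem_polyPiece (v r) (a r)) hG
    exact ⟨_, _, .step r _ F ε hc G η hG ψ hψ _ (sup_span_image_lt_succ _ r)⟩

end IteratedCone

/-! ### The dimension bound. -/

/-- The polynomial ring in the n - m remaining variables maps onto this quotient. -/
theorem ringKrullDim_quotient_span_X_add_le {m : ℕ} {v : Fin m → Fin n}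
    (hv : Function.Injective v) :
    ringKrullDim (Poly k n ⧸ Ideal.span (Set.range fun t => (X (v t) : Poly k n))) +
      (m : WithBot ℕ∞) ≤ (n : WithBot ℕ∞) := by
  classical
  set P : Ideal (Poly k n) := Ideal.span (Set.range fun t => (X (v t) : Poly k n)) with hP
  let g : MvPolynomial {i : Fin n // i ∉ Set.range v} k →ₐ[k] Poly k n ⧸ P :=
    aeval fun i => Ideal.Quotient.mk P (X i.1)
  have hg : Function.Surjective g := by
    intro q
    obtain ⟨p, rfl⟩ := Ideal.Quotient.mk_surjective q
    induction p using MvPolynomial.induction_on with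
    | C c => exact ⟨C c, by rw [algHom_C]; rfl⟩
    | add p q hp hq =>
      obtain ⟨p', hp'⟩ := hp
      obtain ⟨q', hq'⟩ := hq
      exact ⟨p' + q', by rw [map_add, map_add, hp', hq']⟩
    | mul_X p i hp =>
      obtain ⟨p', hp'⟩ := hp
      by_cases hi : i ∈ Set.range v
      · obtain ⟨t, rfl⟩ := hi
        refine ⟨0, ?_⟩
        rw [map_zero, eq_comm, Ideal.Quotient.eq_zero_iff_mem]
        exact P.mul_mem_left _ (Ideal.subset_span ⟨t, rfl⟩)
      · exact ⟨p' * X ⟨i, hi⟩, by rw [map_mul, map_mul, hp', aeval_X]⟩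
  have hle := ringKrullDim_le_of_surjective g.toRingHom hg
  rw [MvPolynomial.ringKrullDim_of_isNoetherianRing, ringKrullDim_eq_zero_of_field,
    zero_add] at hle
  have hcard : Nat.card {i : Fin n // i ∉ Set.range v} + m = n := by
    have h1 : Nat.card (Set.range v) = m := by
      rw [Nat.card_range_of_injective hv, Nat.card_eq_fintype_card, Fintype.card_fin]
    have h2 := Nat.card_congr (Equiv.sumCompl (· ∈ Set.range v))
    rw [Nat.card_sum, Nat.card_eq_fintype_card (α := Fin n), Fintype.card_fin] at h2
    have h3 : Nat.card {i // i ∈ Set.range v} = m := h1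
    omega
  calc _ ≤ ((Nat.card {i : Fin n // i ∉ Set.range v} : ℕ) : WithBot ℕ∞) + m := by gcongr
    _ = _ := by exact_mod_cast congrArg (Nat.cast (R := WithBot ℕ∞)) hcard

/-- A prime containing a power of a variable contains the variable, so chains of primes over I are
chains over the ideal of these variables. -/
theorem ringKrullDim_quotient_le_of_X_pow_mem {I : Ideal (Poly k n)} {m : ℕ} {v : Fin m → Fin n}
    {a : Fin m → ℕ} (h : ∀ t, (X (v t) : Poly k n) ^ a t ∈ I) :
    ringKrullDim (Poly k n ⧸ I) ≤
      ringKrullDim (Poly k n ⧸ Ideal.span (Set.range fun t => (X (v t) : Poly k n))) := by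
  rw [ringKrullDim_quotient, ringKrullDim_quotient]
  have hsub : PrimeSpectrum.zeroLocus (I : Set (Poly k n)) ⊆ PrimeSpectrum.zeroLocus
      (Ideal.span (Set.range fun t => (X (v t) : Poly k n)) : Set (Poly k n)) := by
    intro p hp
    rw [PrimeSpectrum.mem_zeroLocus] at hp ⊢
    rw [SetLike.coe_subset_coe, Ideal.span_le]
    rintro _ ⟨t, rfl⟩
    exact p.2.mem_of_pow_mem _ (hp (h t))
  exact Order.krullDim_le_of_strictMono (Set.inclusion hsub) fun _ _ h => h

end MonomialCone

end

theorem theorem4p1 {k : Type*} [Field k] {n m : ℕ}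
    (J I : Ideal (MvPolynomial (Fin n) k)) (hJ : IsMonomialIdeal J)
    (v : Fin m → Fin n) (hv : Function.Injective v)
    (a : Fin m → ℕ) (ha : ∀ t, 0 < a t)
    (hI : I = J ⊔ Ideal.span (Set.range fun t => (X (v t) : MvPolynomial (Fin n) k) ^ a t))
    (hG : minGens I =
      minGens J ∪ Set.range fun t => (X (v t) : MvPolynomial (Fin n) k) ^ a t) :
    -- the minimal graded free resolution of `R/I` is obtained by iterated mapping cones
    -- starting from that of `R/J`
    ((∃ (F₀ : GradedComplex k n)
        (ε₀ : F₀.Mod 0 →ₗ[MvPolynomial (Fin n) k] (MvPolynomial (Fin n) k ⧸ J)),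
        F₀.IsMinRes (quotPiece J 0) ε₀) ∧
      ∀ (F₀ : GradedComplex k n)
        (ε₀ : F₀.Mod 0 →ₗ[MvPolynomial (Fin n) k] (MvPolynomial (Fin n) k ⧸ J)),
        F₀.IsMinRes (quotPiece J 0) ε₀ →
        (∃ (F : GradedComplex k n)
            (ε : F.Mod 0 →ₗ[MvPolynomial (Fin n) k] (MvPolynomial (Fin n) k ⧸ I)),
            IteratedCone (fun t => X (v t) ^ a t) a J F₀ ε₀ m I F ε) ∧
        ∀ (F : GradedComplex k n)
            (ε : F.Mod 0 →ₗ[MvPolynomial (Fin n) k] (MvPolynomial (Fin n) k ⧸ I)),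
            IteratedCone (fun t => X (v t) ^ a t) a J F₀ ε₀ m I F ε →
              F.IsMinRes (quotPiece I 0) ε) ∧
    -- the Krull dimension of `R/I`
    ringKrullDim (MvPolynomial (Fin n) k ⧸ I) + (m : WithBot ℕ∞) ≤ (n : WithBot ℕ∞) ∧
    -- the graded Betti numbers of `R/I`
    ∀ i j : ℤ, quotBetti I i j =
      ∑ σ : Finset (Fin m),
        quotBetti (J.colon {∏ t ∈ σ, (X (v t) : MvPolynomial (Fin n) k) ^ a t})
          (i - σ.card) (j - ∑ t ∈ σ, (a t : ℤ)) := by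
  have hmem : ∀ t, (X (v t) : MvPolynomial (Fin n) k) ^ a t ∈ I := fun t => by
    rw [hI]
    exact Ideal.mem_sup_right (Ideal.subset_span ⟨t, rfl⟩)
  have hst : ∀ t, ColonStable J (v t) (a t) := fun t =>
    colonStable_of_minGens_subset hJ (hG ▸ Set.subset_union_left) (hmem t)
  refine ⟨⟨exists_isMinRes hJ.isHomogIdeal 0, fun F₀ ε₀ hF₀ => ⟨?_, fun F ε hc =>
    (hc.isMinRes hJ hv ha hst hF₀).2⟩⟩, ?_, fun i j => ?_⟩
  · have h := exists_iteratedCone hJ hv ha hst hF₀ m le_rfl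
    have huniv : {s : Fin m | (s : ℕ) < m} = Set.univ := Set.eq_univ_of_forall fun s => s.2
    rw [huniv, Set.image_univ, ← hI] at h
    exact h
  -- The additive form of the bound also covers I = R, where the dimension is ⊥.
  · exact (add_le_add_left (ringKrullDim_quotient_le_of_X_pow_mem hmem) _).trans
      (ringKrullDim_quotient_span_X_add_le hv)
  · have h := quotBetti_sup_span_X_pow hv ha Finset.univ hJ (fun t _ => hst t) i j
    rw [Finset.coe_univ, Set.image_univ, ← hI, Finset.powerset_univ] at h
    exact h
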